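/- All Lie algebras and vector spaces are complex and finite-dimensional. A *quadratic Lie algebra* $(\mathfrak g,B)$ is a Lie algebra $\mathfrak g$ with a non-degenerate symmetric bilinear form $B$ such that $B([X,Y],Z)=B(X,[Y,Z])$ for all $X,Y,Z\in\mathfrak g$. Let $I(X,Y,Z)=B([X,Y],Z)$ be its associated $3$-form and put $\operatorname{dup}(\mathfrak g)=\dim\{\alpha\in\mathfrak g^*\mid \alpha\wedge I=0\}$; $(\mathfrak g,B)$ is *singular* if $\mathfrak g$ is non-Abelian and $\operatorname{dup}(\mathfrak g)\ge 1$. We write $\mathfrak g\simeq\mathfrak g'$ if there is a Lie algebra isomorphism $\mathfrak g\to\mathfrak g'$, and $\mathfrak g\overset{\mathrm i}{\simeq}\mathfrak g'$ (*i-isomorphic*) if there is a Lie algebra isomorphism which is also an isometry of the bilinear forms. A *realization of $(\mathfrak g,B)$ as a double extension* is an orthogonal decomposition $\mathfrak g=(\mathbb C X_0\oplus\mathbb C Y_0)\overset{\perp}{\oplus}\mathfrak q$ with $B(X_0,X_0)=B(Y_0,Y_0)=0$, $B(X_0,Y_0)=1$, together with a linear map $\overline C:\mathfrak q\to\mathfrak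 q$, skew-symmetric with respect to $B|_{\mathfrak q\times\mathfrak q}$, such that $$[X+\lambda X_0+\mu Y_0,\;Y+\lambda' X_0+\mu' Y_0]=\mu\,\overline C(Y)-\mu'\,\overline C(X)+B(\overline C(X),Y)\,X_0$$ for all $X,Y\in\mathfrak q$ and $\lambda,\mu,\lambda',\mu'\in\mathbb C$. Given such a realization, let $\mathfrak q=\mathfrak q_N\oplus\mathfrak q_I$ be the Fitting decomposition of $\overline C$, where $\mathfrak q_N=\bigcup_k\ker\overline C^{\,k}$ and $\mathfrak q_I=\bigcap_k\operatorname{im}\overline C^{\,k}$. The Lie subalgebras $\mathfrak g_N=(\mathbb C X_0\oplus\mathbb C Y_0)\oplus\mathfrak q_N$ and $\mathfrak g_I=(\mathbb C X_0\oplus\mathbb C Y_0)\oplus\mathfrak q_I$, with the restrictions of $B$, are called the *nilpotent* and the *invertible Fitting component* of $\mathfrak g$. **Proposition 6.4.** Let $(\mathfrak g,B)$ and $(\mathfrak g',B')$ be solvable singular quadratic Lie algebras. Both have a realization as a double extension. For any choice of a realization of $\mathfrak g$ and of a realization of $\mathfrak g'$, with corresponding Fitting components $\mathfrak g_N,\mathfrak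 g_I$ and $\mathfrak g'_N,\mathfrak g'_I$: 1. $\mathfrak g\overset{\mathrm i}{\simeq}\mathfrak g'$ if and only if $\mathfrak g_N\overset{\mathrm i}{\simeq}\mathfrak g'_N$ and $\mathfrak g_I\overset{\mathrm i}{\simeq}\mathfrak g'_I$; likewise $\mathfrak g\simeq\mathfrak g'$ if and only if $\mathfrak g_N\simeq\mathfrak g'_N$ and $\mathfrak g_I\simeq\mathfrak g'_I$. 2. $\mathfrak g\simeq\mathfrak g'$ if and only if $\mathfrak g\overset{\mathrm i}{\simeq}\mathfrak g'$. -/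

import Mathlib

noncomputable section

namespace QuadLie

open LinearMap (BilinForm)

section Basic

variable {𝔤 : Type*} [LieRing 𝔤] [LieAlgebra ℂ 𝔤]

/-- `(𝔤, B)` is a quadratic Lie algebra: `B` is a non-degenerate symmetric bilinear form on the
complex Lie algebra `𝔤` which is invariant, that is, `B([X,Y],Z) = B(X,[Y,Z])`.
(Finite-dimensionality of `𝔤` is a separate hypothesis.) -/
structure IsQuadratic (B : BilinForm ℂ 𝔤) : Prop where
  symm : ∀ x y : 𝔤, B x y = B y x
  nondegenerate : B.Nondegenerate
  invariant : ∀ x y z : 𝔤, B ⁅x, y⁆ z = B x ⁅y, z⁆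

/-- The 3-form `I(X,Y,Z) = B([X,Y],Z)` associated to a quadratic Lie algebra. -/
def threeForm {B : BilinForm ℂ 𝔤} (hB : IsQuadratic B) : 𝔤 [⋀^Fin 3]→ₗ[ℂ] ℂ where
  toFun v := B ⁅v 0, v 1⁆ (v 2)
  map_update_add' := by
    intro dec v i x y
    obtain rfl : dec = instDecidableEqFin 3 := Subsingleton.elim _ _
    fin_cases i <;> simp [Function.update]
  map_update_smul' := by
    intro dec v i c x
    obtain rfl : dec = instDecidableEqFin 3 := Subsingleton.elim _ _
    fin_cases i <;> simp [Function.update]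
  map_eq_zero_of_eq' := by
    intro v i j h hij
    have h01 : v 0 = v 1 → B ⁅v 0, v 1⁆ (v 2) = 0 := by
      intro h; simp [h]
    have h12 : v 1 = v 2 → B ⁅v 0, v 1⁆ (v 2) = 0 := by
      intro h; rw [hB.invariant, h]; simp
    have h02 : v 0 = v 2 → B ⁅v 0, v 1⁆ (v 2) = 0 := by
      intro h
      rw [← lie_skew, map_neg, LinearMap.neg_apply, hB.invariant, h]; simp
    fin_cases i <;> fin_cases j <;> simp_all

/-- The exterior product `α ∧ I` of a linear form `α` and an alternating `k`-form `I`,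
as a linear map in `α`:
`(α ∧ I)(v₀,…,v_k) = ∑ᵢ (-1)ⁱ α(vᵢ) I(v₀,…,v̂ᵢ,…,v_k)`. -/
def wedgeRight {k : ℕ} (I : 𝔤 [⋀^Fin k]→ₗ[ℂ] ℂ) :
    Module.Dual ℂ 𝔤 →ₗ[ℂ] 𝔤 [⋀^Fin (k + 1)]→ₗ[ℂ] ℂ where
  toFun α := AlternatingMap.alternatizeUncurryFin (α.smulRight I)
  map_add' α β := by
    rw [← AlternatingMap.alternatizeUncurryFin_add]
    congr 1
    ext x : 1
    simp [add_smul]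
  map_smul' c α := by
    rw [RingHom.id_apply, ← AlternatingMap.alternatizeUncurryFin_smul]
    congr 1
    ext x : 1
    simp [mul_smul]

/-- The `dup`-number: the dimension of `{α ∈ 𝔤* | α ∧ I = 0}`, with `I` the associated 3-form. -/
def dup {B : BilinForm ℂ 𝔤} (hB : IsQuadratic B) : ℕ :=
  Module.finrank ℂ (LinearMap.ker (wedgeRight (threeForm hB)))

/-- A quadratic Lie algebra is singular if it is non-Abelian and its `dup`-number is at least 1. -/
def IsSingular {B : BilinForm ℂ 𝔤} (hB : IsQuadratic B) : Prop :=
  ¬ IsLieAbelian 𝔤 ∧ 1 ≤ dup hB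

/-- The restriction of a bilinear form to a Lie subalgebra. -/
def restrictForm (B : BilinForm ℂ 𝔤) (H : LieSubalgebra ℂ 𝔤) : BilinForm ℂ H :=
  B.compl₁₂ (H.incl : H →ₗ[ℂ] 𝔤) (H.incl : H →ₗ[ℂ] 𝔤)

end Basic

/-- `𝔤 ≃ 𝔤'`: there is a Lie algebra isomorphism. -/
def Isomorphic (𝔤 𝔤' : Type*) [LieRing 𝔤] [LieAlgebra ℂ 𝔤] [LieRing 𝔤'] [LieAlgebra ℂ 𝔤'] : Prop :=
  Nonempty (𝔤 ≃ₗ⁅ℂ⁆ 𝔤')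

/-- `(𝔤, B)` and `(𝔤', B')` are i-isomorphic: there is a Lie algebra isomorphism that is also an
isometry. -/
def IIsomorphic {𝔤 𝔤' : Type*} [LieRing 𝔤] [LieAlgebra ℂ 𝔤] [LieRing 𝔤'] [LieAlgebra ℂ 𝔤']
    (B : BilinForm ℂ 𝔤) (B' : BilinForm ℂ 𝔤') : Prop :=
  ∃ A : 𝔤 ≃ₗ⁅ℂ⁆ 𝔤', ∀ x y : 𝔤, B' (A x) (A y) = B x y

/-- A realization of `(𝔤, B)` as a double extension: a decomposition
`𝔤 = (ℂ X₀ ⊕ ℂ Y₀) ⊕^⊥ 𝔮` with `X₀`, `Y₀` isotropic and `B(X₀, Y₀) = 1`, and a skew-symmetric map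
`C` on `𝔮`, such that the bracket of `𝔤` is that of the double extension of `𝔮` by `C`. -/
structure DoubleExtension {𝔤 : Type*} [LieRing 𝔤] [LieAlgebra ℂ 𝔤] (B : BilinForm ℂ 𝔤) where
  /-- the isotropic vector spanning the central line -/
  X₀ : 𝔤
  /-- the isotropic vector acting on `𝔮` by `C` -/
  Y₀ : 𝔤
  /-- the quadratic vector space that is extended -/
  𝔮 : Submodule ℂ 𝔤
  /-- the skew-symmetric map -/
  C : 𝔮 →ₗ[ℂ] 𝔮
  isCompl : IsCompl (Submodule.span ℂ {X₀, Y₀}) 𝔮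
  X₀_X₀ : B X₀ X₀ = 0
  Y₀_Y₀ : B Y₀ Y₀ = 0
  X₀_Y₀ : B X₀ Y₀ = 1
  X₀_ortho : ∀ x ∈ 𝔮, B X₀ x = 0
  Y₀_ortho : ∀ x ∈ 𝔮, B Y₀ x = 0
  skew : ∀ x y : 𝔮, B (C x) y = -B x (C y)
  lie_eq : ∀ (x y : 𝔮) (a b a' b' : ℂ),
    ⁅(x : 𝔤) + a • X₀ + b • Y₀, (y : 𝔤) + a' • X₀ + b' • Y₀⁆ =
      b • (C y : 𝔤) - b' • (C x : 𝔤) + B (C x) y • X₀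

namespace DoubleExtension

variable {𝔤 : Type*} [LieRing 𝔤] [LieAlgebra ℂ 𝔤] {B : BilinForm ℂ 𝔤}

/-- `𝔮_N`, the Fitting null component of `C`: the vectors killed by some power of `C`. -/
def qN (D : DoubleExtension B) : Submodule ℂ D.𝔮 := ⨆ k : ℕ, LinearMap.ker (D.C ^ k)

/-- `𝔮_I`, the Fitting one component of `C`: the intersection of the images of the powers of `C`. -/
def qI (D : DoubleExtension B) : Submodule ℂ D.𝔮 := ⨅ k : ℕ, LinearMap.range (D.C ^ k)

theorem map_mem_qN (D : DoubleExtension B) : ∀ x ∈ D.qN, D.C x ∈ D.qN := by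
  intro x hx
  have h : D.qN ≤ D.qN.comap D.C := by
    refine iSup_le fun k y hy => ?_
    refine Submodule.mem_iSup_of_mem k ?_
    rw [LinearMap.mem_ker] at hy ⊢
    rw [← Module.End.mul_apply, ← pow_succ, pow_succ', Module.End.mul_apply, hy, map_zero]
  exact h hx

theorem map_mem_qI (D : DoubleExtension B) : ∀ x ∈ D.qI, D.C x ∈ D.qI := by
  intro x hx
  simp only [qI, Submodule.mem_iInf] at hx ⊢
  intro k
  obtain ⟨y, hy⟩ := hx k
  refine ⟨D.C y, ?_⟩
  rw [← Module.End.mul_apply, ← pow_succ, pow_succ', Module.End.mul_apply, hy]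

/-- For a `C`-stable subspace `p` of `𝔮`, the Lie subalgebra `(ℂ X₀ ⊕ ℂ Y₀) ⊕ p` of `𝔤`. -/
def extend (D : DoubleExtension B) (p : Submodule ℂ D.𝔮) (hp : ∀ x ∈ p, D.C x ∈ p) :
    LieSubalgebra ℂ 𝔤 where
  toSubmodule := Submodule.span ℂ {D.X₀, D.Y₀} ⊔ p.map D.𝔮.subtype
  lie_mem' := by
    have key : ∀ z : 𝔤, z ∈ Submodule.span ℂ {D.X₀, D.Y₀} ⊔ p.map D.𝔮.subtype →
        ∃ x ∈ p, ∃ a b : ℂ, z = (x : 𝔤) + a • D.X₀ + b • D.Y₀ := by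
      intro z hz
      obtain ⟨t, ht, s, ⟨x, hx, rfl⟩, rfl⟩ := Submodule.mem_sup.1 hz
      obtain ⟨a, b, rfl⟩ := Submodule.mem_span_pair.1 ht
      exact ⟨x, hx, a, b, by simp only [Submodule.subtype_apply]; abel⟩
    intro z w hz hw
    obtain ⟨x, hx, a, b, rfl⟩ := key z hz
    obtain ⟨y, hy, a', b', rfl⟩ := key w hw
    have hmem : ∀ u ∈ p,
        (u : 𝔤) ∈ Submodule.span ℂ {D.X₀, D.Y₀} ⊔ p.map D.𝔮.subtype := fun u hu =>
      Submodule.mem_sup_right ⟨u, hu, rfl⟩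
    have hX : D.X₀ ∈ Submodule.span ℂ {D.X₀, D.Y₀} ⊔ p.map D.𝔮.subtype :=
      Submodule.mem_sup_left (Submodule.subset_span (by simp))
    change _ ∈ Submodule.span ℂ {D.X₀, D.Y₀} ⊔ p.map D.𝔮.subtype
    rw [D.lie_eq]
    exact Submodule.add_mem _ (Submodule.sub_mem _ (Submodule.smul_mem _ _ (hmem _ (hp y hy)))
      (Submodule.smul_mem _ _ (hmem _ (hp x hx)))) (Submodule.smul_mem _ _ hX)

/-- The nilpotent Fitting component `𝔤_N = (ℂ X₀ ⊕ ℂ Y₀) ⊕ 𝔮_N`. -/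
def gN (D : DoubleExtension B) : LieSubalgebra ℂ 𝔤 := D.extend D.qN D.map_mem_qN

/-- The invertible Fitting component `𝔤_I = (ℂ X₀ ⊕ ℂ Y₀) ⊕ 𝔮_I`. -/
def gI (D : DoubleExtension B) : LieSubalgebra ℂ 𝔤 := D.extend D.qI D.map_mem_qI

/-- The form of `𝔤_N`, the restriction of `B`. -/
def formN (D : DoubleExtension B) : BilinForm ℂ D.gN := restrictForm B D.gN

/-- The form of `𝔤_I`, the restriction of `B`. -/
def formI (D : DoubleExtension B) : BilinForm ℂ D.gI := restrictForm B D.gI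

end DoubleExtension

end QuadLie

end

noncomputable section

namespace QuadLie

open LinearMap (BilinForm)

/-! ### Square roots of operators, and promoting conjugacies -/

section LinearAlgebra

open Polynomial

/-! Everything reduces to one relation on the skew maps: `ScalarConj C C'`, conjugacy up to a
nonzero scalar. For double extensions by `C` and `C'`, isomorphism and i-isomorphism are both
equivalent to it, and the Fitting components are themselves double extensions, by the restrictions
of `C`.

From scalar conjugacy to i-isomorphism: a polar decomposition replaces the conjugating map by an
isometry (`exists_isometry_of_conj`), and the scalar is absorbed by rescaling the hyperbolic plane
(`IsExtension.iIsomorphic`).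

From isomorphism to scalar conjugacy (`scalarConj_of_extBracket`): if `C` has rank above 2, the
hyperplane `V ⊕ ℂ X₀` consists of the vectors whose adjoint map has rank at most 2, so an
isomorphism preserves it, and its action modulo `ℂ X₀` is the conjugacy. In rank at most 2 this can
fail. There the dimensions of the derived algebra and of its intersection with the centre give the
ranks of `C` and `C ^ 2`, which suffice for a skew map of such small rank
(`scalarConj_of_finrank_le_two`).

Scalar conjugacy is compatible with Fitting decompositions (`scalarConj_iff_fitting`): the two
components may come with different scalars, but a nilpotent map is conjugate to all its nonzero
multiples.

A realization exists because the vectors dual to the forms `α` with `α ∧ I = 0` make up a nonzero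
ideal, in which Lie's theorem finds a central isotropic vector. -/

theorem exists_prod_dvd_sq_sub_X (s : Multiset ℂ) (hs : (0 : ℂ) ∉ s) :
    ∃ p : ℂ[X], (s.map fun a => X - C a).prod ∣ p ^ 2 - X := by
  induction s using Multiset.induction with
  | empty => exact ⟨0, by simp⟩
  | cons a s ih =>
    rw [Multiset.mem_cons, not_or] at hs
    obtain ⟨p, g, hg⟩ := ih hs.2
    set m := (s.map fun a => X - C a).prod
    -- With `p ^ 2 - X = m * g`, replacing `p` by `p + c m` turns the cofactor `g` into `g + 2 p c +
    -- m c ^ 2`, which must vanish at `a`. If `a` is already a root of `m`, this equation is linear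
    -- in `c`, and solvable because `p(a) ^ 2 = a ≠ 0`.
    have hquad : ∃ c : ℂ, g.eval a + 2 * p.eval a * c + m.eval a * c ^ 2 = 0 := by
      by_cases hm : m.eval a = 0
      · have h := congrArg (Polynomial.eval a) hg
        simp only [eval_sub, eval_pow, eval_X, eval_mul, hm, zero_mul] at h
        have hp : p.eval a ≠ 0 := by
          intro h0
          apply hs.1
          rw [h0] at h
          linear_combination h
        refine ⟨-g.eval a / (2 * p.eval a), ?_⟩
        rw [hm]
        field_simp
        ring
      · obtain ⟨d, hd⟩ := IsAlgClosed.exists_eq_mul_self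
          (discrim (m.eval a) (2 * p.eval a) (g.eval a))
        obtain ⟨c, hc⟩ := exists_quadratic_eq_zero hm ⟨d, hd⟩
        exact ⟨c, by linear_combination hc⟩
    obtain ⟨c, hc⟩ := hquad
    refine ⟨p + C c * m, ?_⟩
    rw [Multiset.map_cons, Multiset.prod_cons]
    have hroot : (X - C a) ∣ g + 2 * p * C c + m * C c ^ 2 := by
      rw [dvd_iff_isRoot, IsRoot.def]
      simpa using hc
    obtain ⟨r, hr⟩ := hroot
    exact ⟨r, by linear_combination hg + m * hr⟩

variable {V : Type*} [AddCommGroup V] [Module ℂ V] [Module.Finite ℂ V]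

/-- An injective endomorphism of a finite-dimensional complex space has a square root that is a
polynomial in it. -/
theorem exists_aeval_sq_eq (f : Module.End ℂ V) (hf : Function.Injective f) :
    ∃ p : ℂ[X], aeval f p * aeval f p = f := by
  have h0 : (0 : ℂ) ∉ (minpoly ℂ f).roots := by
    intro h
    have h1 := isRoot_of_mem_roots h
    rw [← Module.End.hasEigenvalue_iff_isRoot] at h1
    obtain ⟨v, hv⟩ := h1.exists_hasEigenvector
    apply hv.2
    apply hf
    rw [hv.apply_eq_smul]
    simp
  obtain ⟨p, hp⟩ := exists_prod_dvd_sq_sub_X _ h0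
  refine ⟨p, ?_⟩
  rw [← (IsAlgClosed.splits (minpoly ℂ f)).eq_prod_roots_of_monic
    (minpoly.monic (Algebra.IsIntegral.isIntegral f))] at hp
  obtain ⟨q, hq⟩ := hp
  have := congrArg (aeval f) hq
  simp only [map_sub, map_pow, aeval_X, map_mul, minpoly.aeval, zero_mul] at this
  rw [← sq]
  exact sub_eq_zero.1 this

variable {V' : Type*} [AddCommGroup V'] [Module ℂ V']

/-- Linearly conjugate skew-symmetric maps are conjugate by an isometry. -/
theorem exists_isometry_of_conj {β : BilinForm ℂ V} {β' : BilinForm ℂ V'}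
    (hs : ∀ x y, β x y = β y x) (hn : β.Nondegenerate)
    (hs' : ∀ x y, β' x y = β' y x) (hn' : β'.Nondegenerate)
    {C : V →ₗ[ℂ] V} {C' : V' →ₗ[ℂ] V'}
    (hC : ∀ x y, β (C x) y = -β x (C y)) (hC' : ∀ x y, β' (C' x) y = -β' x (C' y))
    (P : V ≃ₗ[ℂ] V') (hP : ∀ x, P (C x) = C' (P x)) :
    ∃ U : V ≃ₗ[ℂ] V', (∀ x, U (C x) = C' (U x)) ∧ ∀ x y, β' (U x) (U y) = β x y := by
  let b : BilinForm ℂ V := β'.compl₁₂ (P : V →ₗ[ℂ] V') (P : V →ₗ[ℂ] V')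
  have hb : ∀ x y, b x y = β' (P x) (P y) := fun x y => rfl
  -- `S` plays the role of `P* P` in a polar decomposition: it measures how far `P` is from an
  -- isometry.
  let S : Module.End ℂ V := LinearMap.BilinForm.symmCompOfNondegenerate b β hn
  have hS : ∀ x y, β (S x) y = β' (P x) (P y) := fun x y => by
    rw [← hb, LinearMap.BilinForm.comp_symmCompOfNondegenerate_apply]
  have hsep : ∀ x y, (∀ z, β x z = β y z) → x = y := by
    intro x y h
    refine sub_eq_zero.1 (hn.1 _ fun z => ?_)
    rw [map_sub, LinearMap.sub_apply, h, sub_self]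
  have hSinj : Function.Injective S := by
    rw [injective_iff_map_eq_zero]
    intro x hx
    have : P x = 0 := by
      refine hn'.1 _ fun z => ?_
      obtain ⟨y, rfl⟩ := P.surjective z
      rw [← hS, hx, map_zero, LinearMap.zero_apply]
    simpa using this
  have hSC : Commute S C := by
    refine LinearMap.ext fun x => hsep _ _ fun z => ?_
    rw [Module.End.mul_apply, Module.End.mul_apply, hS, hP, hC', ← hP, ← hS, hC]
  -- A square root that is a polynomial in `S` inherits from `S` both self-adjointness and
  -- commutation with `C`, so `P ∘ T⁻¹` is an isometry that still intertwines.
  obtain ⟨p, hp⟩ := exists_aeval_sq_eq S hSinj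
  set T := aeval S p with hT
  have hTC : Commute T C :=
    (Algebra.commute_of_mem_adjoin_singleton_of_commute
      (Polynomial.aeval_mem_adjoin_singleton ℂ S) hSC.symm).symm
  have hTself : ∀ x y, β (T x) y = β x (T y) := by
    rw [hT]
    clear hTC hp hT T
    induction p using Polynomial.induction_on' with
    | add p q h1 h2 =>
      intro x y
      simp only [map_add, LinearMap.add_apply, h1, h2]
    | monomial n a =>
      have : ∀ n x y, β ((S ^ n) x) y = β x ((S ^ n) y) := by
        intro n
        induction n with
        | zero => simp
        | succ n ih =>
          intro x y
          rw [pow_succ, Module.End.mul_apply, ih, hS, hs', ← hS, hs, ← Module.End.mul_apply,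
            ← pow_succ', ← pow_succ]
      intro x y
      simp only [aeval_monomial, Module.End.mul_apply, Module.algebraMap_end_apply, map_smul,
        LinearMap.smul_apply, this]
  have hTT : ∀ x, T (T x) = S x := fun x => by rw [← Module.End.mul_apply, hp]
  have hTinj : Function.Injective T := by
    intro x y h
    apply hSinj
    rw [← hTT, ← hTT, h]
  let E : V ≃ₗ[ℂ] V := LinearEquiv.ofInjectiveEndo T hTinj
  have hE : ∀ x, E x = T x := fun x => rfl
  refine ⟨E.symm.trans P, fun x => ?_, fun x y => ?_⟩
  · obtain ⟨z, rfl⟩ := E.surjective x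
    have h1 : C (E z) = E (C z) := by
      rw [hE, hE, ← Module.End.mul_apply, ← Module.End.mul_apply, hTC.eq]
    simp [h1, hP]
  · obtain ⟨z, rfl⟩ := E.surjective x
    obtain ⟨w, rfl⟩ := E.surjective y
    simp only [LinearEquiv.trans_apply, LinearEquiv.symm_apply_apply]
    rw [← hS, hE, hE, ← hTT, hTself]

variable [Module.Finite ℂ V']

/-- An intertwining isomorphism between the ranges of two endomorphisms of spaces of the same
dimension extends to an intertwining isomorphism of the spaces. -/
theorem exists_conj_of_range (hdim : Module.finrank ℂ V = Module.finrank ℂ V')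
    (C : V →ₗ[ℂ] V) (C' : V' →ₗ[ℂ] V')
    (Q : LinearMap.range C ≃ₗ[ℂ] LinearMap.range C')
    (hQ : ∀ x : LinearMap.range C, (Q (C.rangeRestrict x) : V') = C' (Q x)) :
    ∃ P : V ≃ₗ[ℂ] V', ∀ x, P (C x) = C' (P x) := by
  obtain ⟨s, hs⟩ := C'.rangeRestrict.exists_rightInverse_of_surjective C'.range_rangeRestrict
  have hs' : ∀ y : LinearMap.range C', C' (s y) = y := fun y =>
    congrArg Subtype.val (LinearMap.congr_fun hs y)
  -- `P₁` satisfies `C' P₁ = Q C` but need not agree with `Q` on the range. The discrepancy `δ` lies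
  -- in `ker C'`, so subtracting an extension of it keeps the relation.
  let P₁ : V →ₗ[ℂ] V' := s ∘ₗ (Q : LinearMap.range C →ₗ[ℂ] LinearMap.range C') ∘ₗ C.rangeRestrict
  have hP₁ : ∀ x, C' (P₁ x) = Q (C.rangeRestrict x) := fun x => hs' _
  let δ : LinearMap.range C →ₗ[ℂ] LinearMap.ker C' :=
    (P₁ ∘ₗ (LinearMap.range C).subtype -
      (LinearMap.range C').subtype ∘ₗ (Q : LinearMap.range C →ₗ[ℂ] LinearMap.range C')).codRestrict
      (LinearMap.ker C') (fun x => by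
        rw [LinearMap.mem_ker]
        simp only [LinearMap.sub_apply, LinearMap.comp_apply, Submodule.subtype_apply, map_sub, hP₁,
          hQ, LinearEquiv.coe_coe, sub_self])
  have hδ : ∀ x, (δ x : V') = P₁ x - Q x := fun x => rfl
  obtain ⟨δ', hδ'⟩ := δ.exists_extend
  let P₂ : V →ₗ[ℂ] V' := P₁ - (LinearMap.ker C').subtype ∘ₗ δ'
  have hP₂ : ∀ x, C' (P₂ x) = Q (C.rangeRestrict x) := fun x => by
    have : C' (δ' x) = 0 := (δ' x).2
    simp [P₂, hP₁, this]
  have hP₂' : ∀ x : LinearMap.range C, P₂ x = Q x := fun x => by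
    have : δ' x = δ x := LinearMap.congr_fun hδ' x
    simp [P₂, this, hδ]
  have hdisj : Disjoint (LinearMap.ker P₂) (LinearMap.range C) := by
    rw [Submodule.disjoint_def]
    intro x hx hx'
    have h1 := hP₂' ⟨x, hx'⟩
    rw [LinearMap.mem_ker] at hx
    rw [hx] at h1
    have h2 : Q ⟨x, hx'⟩ = 0 := Subtype.ext h1.symm
    have h3 := (LinearEquiv.map_eq_zero_iff Q).1 h2
    exact congrArg Subtype.val h3
  -- `P₂` may fail to be bijective. It is repaired by sending its kernel isomorphically to a
  -- complement `M` of its range. Taking `W` above the range of `C` and `M` inside `ker C'` makes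
  -- the correction invisible to the intertwining relation.
  obtain ⟨W, hW, hWc⟩ := hdisj.symm.exists_isCompl
  have hcod : Codisjoint (LinearMap.ker C') (LinearMap.range P₂) := by
    rw [codisjoint_iff, eq_top_iff]
    intro y _
    obtain ⟨x, hx⟩ := C.surjective_rangeRestrict (Q.symm (C'.rangeRestrict y))
    rw [← sub_add_cancel y (P₂ x)]
    refine Submodule.add_mem_sup ?_ ⟨x, rfl⟩
    rw [LinearMap.mem_ker, map_sub, hP₂, hx]
    simp
  obtain ⟨M, hM, hMc⟩ := hcod.exists_isCompl
  have hfin : Module.finrank ℂ (LinearMap.ker P₂) = Module.finrank ℂ M := by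
    have h1 := LinearMap.finrank_range_add_finrank_ker P₂
    have h2 := Submodule.finrank_add_eq_of_isCompl hMc
    omega
  let J := LinearEquiv.ofFinrankEq _ _ hfin
  let pr := Submodule.projectionOnto _ _ hWc.symm
  let P : V →ₗ[ℂ] V' := P₂ + M.subtype ∘ₗ (J : _ →ₗ[ℂ] _) ∘ₗ pr
  have hPx : ∀ x, P x = P₂ x + J (pr x) := fun x => rfl
  have hinj : Function.Injective P := by
    rw [injective_iff_map_eq_zero]
    intro x hx
    rw [hPx] at hx
    have h1 : P₂ x = 0 := by
      have : P₂ x ∈ M := by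
        rw [eq_neg_of_add_eq_zero_left hx]
        exact M.neg_mem (J (pr x)).2
      exact (Submodule.disjoint_def.1 hMc.disjoint) _ this ⟨x, rfl⟩
    rw [h1, zero_add] at hx
    have h2 : pr x = 0 := by
      have : J (pr x) = 0 := Subtype.ext hx
      simpa using this
    have h3 := Submodule.projectionOnto_apply_left hWc.symm ⟨x, h1⟩
    have h4 : (⟨x, h1⟩ : LinearMap.ker P₂) = 0 := by rw [← h3]; exact h2
    exact congrArg Subtype.val h4
  refine ⟨LinearEquiv.ofInjectiveOfFinrankEq P hinj hdim, fun x => ?_⟩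
  change P (C x) = C' (P x)
  have h1 : pr (C x) = 0 :=
    Submodule.projectionOnto_apply_of_mem_right _ (hW ⟨x, rfl⟩)
  have h2 : C' (J (pr x)) = 0 := hM (J (pr x)).2
  rw [hPx, hPx, map_add, h1, h2, hP₂, map_zero, Submodule.coe_zero, add_zero, add_zero]
  exact hP₂' (C.rangeRestrict x)

end LinearAlgebra

/-! ### Nilpotent endomorphisms and the ranks of their powers -/

section NilpotentMaps

universe u v

/-- The rank of the powers of the restriction of an endomorphism to its range. -/
theorem finrank_range_restrict_pow {V : Type*} [AddCommGroup V] [Module ℂ V]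
    (C : Module.End ℂ V) (h : ∀ x ∈ LinearMap.range C, C x ∈ LinearMap.range C) (j : ℕ) :
    Module.finrank ℂ (LinearMap.range ((C.restrict h) ^ j)) =
      Module.finrank ℂ (LinearMap.range (C ^ (j + 1))) := by
  have h1 : C ^ (j + 1) =
      (LinearMap.range C).subtype ∘ₗ (((C.restrict h) ^ j) ∘ₗ C.rangeRestrict) := by
    refine LinearMap.ext fun x => ?_
    rw [pow_succ, Module.End.mul_apply, LinearMap.comp_apply, LinearMap.comp_apply,
      Module.End.pow_restrict]
    rfl
  rw [h1, LinearMap.range_comp, LinearMap.range_comp_of_range_eq_top _ C.range_rangeRestrict]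
  exact (LinearEquiv.finrank_eq
    (Submodule.equivMapOfInjective _ (Submodule.injective_subtype _) _))

/-- Two nilpotent endomorphisms whose powers have the same ranks are conjugate. -/
theorem exists_conj_of_pow_eq_zero (k : ℕ) :
    ∀ (V : Type u) (V' : Type v) [AddCommGroup V] [Module ℂ V] [Module.Finite ℂ V]
      [AddCommGroup V'] [Module ℂ V'] [Module.Finite ℂ V']
      (C : Module.End ℂ V) (C' : Module.End ℂ V'), C ^ k = 0 → C' ^ k = 0 →
      (∀ j, Module.finrank ℂ (LinearMap.range (C ^ j)) =
        Module.finrank ℂ (LinearMap.range (C' ^ j))) →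
      ∃ P : V ≃ₗ[ℂ] V', ∀ x, P (C x) = C' (P x) := by
  induction k with
  | zero =>
    intro V V' _ _ _ _ _ _ C C' h h' hr
    have h0 := hr 0
    rw [pow_zero, pow_zero, Module.End.one_eq_id, Module.End.one_eq_id, LinearMap.range_id,
      LinearMap.range_id, finrank_top, finrank_top] at h0
    refine ⟨LinearEquiv.ofFinrankEq _ _ h0, fun x => ?_⟩
    have hz : ∀ y : V', y = 0 := fun y => by
      have := LinearMap.congr_fun h' y
      simpa using this
    rw [hz (C' _), hz (LinearEquiv.ofFinrankEq _ _ h0 _)]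
  | succ k ih =>
    intro V V' _ _ _ _ _ _ C C' h h' hr
    have h0 := hr 0
    rw [pow_zero, pow_zero, Module.End.one_eq_id, Module.End.one_eq_id, LinearMap.range_id,
      LinearMap.range_id, finrank_top, finrank_top] at h0
    have hC : ∀ x ∈ LinearMap.range C, C x ∈ LinearMap.range C := fun x _ => ⟨x, rfl⟩
    have hC' : ∀ x ∈ LinearMap.range C', C' x ∈ LinearMap.range C' := fun x _ => ⟨x, rfl⟩
    have hz : (C.restrict hC) ^ k = 0 := by
      rw [← LinearMap.range_eq_bot, ← Submodule.finrank_eq_zero (R := ℂ),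
        finrank_range_restrict_pow, h, LinearMap.range_zero, finrank_bot]
    have hz' : (C'.restrict hC') ^ k = 0 := by
      rw [← LinearMap.range_eq_bot, ← Submodule.finrank_eq_zero (R := ℂ),
        finrank_range_restrict_pow, h', LinearMap.range_zero, finrank_bot]
    -- Restricting to the range shifts the sequence of ranks by one and lowers the nilpotency
    -- exponent.
    obtain ⟨Q, hQ⟩ := ih (LinearMap.range C) (LinearMap.range C') (C.restrict hC)
      (C'.restrict hC') hz hz' (fun j => by
        rw [finrank_range_restrict_pow, finrank_range_restrict_pow, hr])
    exact exists_conj_of_range h0 C C' Q fun x => congrArg Subtype.val (hQ x)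

variable {V : Type*} [AddCommGroup V] [Module ℂ V] {V' : Type*} [AddCommGroup V'] [Module ℂ V']

theorem exists_conj_of_isNilpotent [Module.Finite ℂ V] [Module.Finite ℂ V']
    {C : Module.End ℂ V} {C' : Module.End ℂ V'} (h : IsNilpotent C) (h' : IsNilpotent C')
    (hr : ∀ j, Module.finrank ℂ (LinearMap.range (C ^ j)) =
      Module.finrank ℂ (LinearMap.range (C' ^ j))) :
    ∃ P : V ≃ₗ[ℂ] V', ∀ x, P (C x) = C' (P x) := by
  obtain ⟨k, hk⟩ := h
  obtain ⟨k', hk'⟩ := h'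
  exact exists_conj_of_pow_eq_zero (max k k') V V' C C' (pow_eq_zero_of_le (le_max_left _ _) hk)
    (pow_eq_zero_of_le (le_max_right _ _) hk') hr

/-- A nilpotent endomorphism is conjugate to its nonzero multiples. -/
theorem exists_conj_smul_of_isNilpotent [Module.Finite ℂ V] {C : Module.End ℂ V} (h : IsNilpotent C)
    {c : ℂ} (hc : c ≠ 0) : ∃ P : V ≃ₗ[ℂ] V, ∀ x, P (C x) = c • C (P x) := by
  obtain ⟨k, hk⟩ := h
  exact exists_conj_of_isNilpotent (C' := c • C) ⟨k, hk⟩ ⟨k, by rw [smul_pow, hk, smul_zero]⟩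
    fun j => by rw [smul_pow, LinearMap.range_smul _ _ (pow_ne_zero j hc)]

/-- Endomorphisms of complex vector spaces that are conjugate up to a nonzero scalar. -/
def ScalarConj (C : V →ₗ[ℂ] V) (C' : V' →ₗ[ℂ] V') : Prop :=
  ∃ c : ℂ, c ≠ 0 ∧ ∃ P : V ≃ₗ[ℂ] V', ∀ x, P (C x) = c • C' (P x)

theorem range_pow_add_eq {C : Module.End ℂ V} {j : ℕ}
    (h : LinearMap.range (C ^ (j + 1)) = LinearMap.range (C ^ j)) (m : ℕ) :
    LinearMap.range (C ^ (j + m)) = LinearMap.range (C ^ j) := by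
  induction m with
  | zero => rfl
  | succ m ih =>
    rw [← add_assoc, pow_succ', Module.End.mul_eq_comp, LinearMap.range_comp, ih,
      ← LinearMap.range_comp, ← Module.End.mul_eq_comp, ← pow_succ', h]

/-- Once two consecutive ranges agree, all later ones do, so a nonzero stalled range would
contradict nilpotency. -/
theorem finrank_range_pow_succ_lt [Module.Finite ℂ V] {C : Module.End ℂ V} (hC : IsNilpotent C)
    {j : ℕ} (hj : C ^ j ≠ 0) :
    Module.finrank ℂ (LinearMap.range (C ^ (j + 1))) <
      Module.finrank ℂ (LinearMap.range (C ^ j)) := by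
  refine Submodule.finrank_lt_finrank_of_lt (lt_of_le_of_ne ?_ fun h => hj ?_)
  · rw [pow_succ, Module.End.mul_eq_comp]
    exact LinearMap.range_comp_le_range _ _
  · obtain ⟨k, hk⟩ := hC
    rw [← LinearMap.range_eq_bot, ← range_pow_add_eq h k, pow_add, hk, mul_zero,
      LinearMap.range_zero]

/-- The generalized eigenspaces span over `ℂ`, and only the one for `0` can be nonzero; it is the
kernel of a power. -/
theorem isNilpotent_of_eigenvalue_eq_zero [Module.Finite ℂ V] {C : Module.End ℂ V}
    (h : ∀ a, C.HasEigenvalue a → a = 0) : IsNilpotent C := by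
  have h1 := Module.End.iSup_maxGenEigenspace_eq_top C
  have h2 : ⨆ a, C.maxGenEigenspace a ≤ C.maxGenEigenspace 0 := by
    refine iSup_le fun a => ?_
    by_cases ha : a = 0
    · rw [ha]
    · have : C.maxGenEigenspace a = ⊥ := by
        by_contra hne
        refine ha (h a ?_)
        rw [Module.End.maxGenEigenspace_eq] at hne
        exact Module.End.hasEigenvalue_of_hasGenEigenvalue (k := C.maxGenEigenspaceIndex a) hne
      rw [this]
      exact bot_le
  rw [h1, top_le_iff, Module.End.maxGenEigenspace_eq] at h2
  refine ⟨C.maxGenEigenspaceIndex 0, ?_⟩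
  rw [← LinearMap.ker_eq_top, ← h2, Module.End.genEigenspace_nat]
  simp

/-- Rank-nullity for `C` restricted to its range. It recovers the rank of `C ^ 2` from `range C ⊓
ker C`, which the Lie algebra sees. -/
theorem finrank_range_sq_add [Module.Finite ℂ V] (C : Module.End ℂ V) :
    Module.finrank ℂ (LinearMap.range (C ^ 2)) +
      Module.finrank ℂ (LinearMap.range C ⊓ LinearMap.ker C : Submodule ℂ V) =
      Module.finrank ℂ (LinearMap.range C) := by
  have h := LinearMap.finrank_range_add_finrank_ker (C.domRestrict (LinearMap.range C))
  rw [LinearMap.range_domRestrict, LinearMap.ker_domRestrict] at h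
  rw [sq, Module.End.mul_eq_comp, LinearMap.range_comp, ← h]
  congr 1
  rw [← Submodule.map_comap_subtype]
  exact (LinearEquiv.finrank_eq
    (Submodule.equivMapOfInjective _ (Submodule.injective_subtype _) _)).symm

theorem ne_zero_of_hasEigenvalue {C : Module.End ℂ V} {a : ℂ} (ha : a ≠ 0)
    (hCa : C.HasEigenvalue a) : C ^ 1 ≠ 0 := by
  rintro h
  obtain ⟨w, hw⟩ := hCa.exists_hasEigenvector
  have := hw.apply_eq_smul
  rw [pow_one] at h
  rw [h, LinearMap.zero_apply] at this
  exact (smul_ne_zero ha hw.2) this.symm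

end NilpotentMaps

/-! ### Skew-symmetric maps of rank at most two -/

section SkewMaps

variable {V : Type*} [AddCommGroup V] [Module ℂ V] [Module.Finite ℂ V]
  {V' : Type*} [AddCommGroup V'] [Module ℂ V'] [Module.Finite ℂ V']

/-- The range of a skew-symmetric map of rank at most two with a nonzero eigenvalue `a` is the sum
of the eigenlines for `a` and `-a`. -/
theorem exists_equiv_range_of_hasEigenvalue {β : BilinForm ℂ V} (hn : β.Nondegenerate)
    {C : Module.End ℂ V} (hC : ∀ x y, β (C x) y = -β x (C y))
    (hr : Module.finrank ℂ (LinearMap.range C) ≤ 2) {a : ℂ} (ha : a ≠ 0)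
    (hCa : C.HasEigenvalue a) :
    ∃ φ : (ℂ × ℂ) ≃ₗ[ℂ] LinearMap.range C, ∀ s t, C (φ (s, t)) = φ (a * s, -(a * t)) := by
  obtain ⟨w, hw⟩ := hCa.exists_hasEigenvector
  have hw0 : w ≠ 0 := hw.2
  have hCw : C w = a • w := hw.apply_eq_smul
  obtain ⟨w', hw0', hCw'⟩ : ∃ w', w' ≠ 0 ∧ C w' = -(a • w') := by
    -- Eigenvalues of a skew map come in opposite pairs: `w` is orthogonal to the range of `C + a`,
    -- so `C + a` cannot be bijective.
    by_contra! hne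
    have hinj : Function.Injective (C + a • LinearMap.id : V →ₗ[ℂ] V) := by
      rw [injective_iff_map_eq_zero]
      intro x hx
      by_contra hx0
      exact hne x hx0 (eq_neg_of_add_eq_zero_left hx)
    refine hw0 (hn.1 _ fun z => ?_)
    obtain ⟨y, rfl⟩ := LinearMap.injective_iff_surjective.1 hinj z
    have := hC w y
    rw [hCw] at this
    simp only [LinearMap.add_apply, LinearMap.smul_apply, LinearMap.id_apply, map_add, map_smul,
      smul_eq_mul] at this ⊢
    linear_combination this
  let φ₀ : (ℂ × ℂ) →ₗ[ℂ] V :=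
    (LinearMap.toSpanSingleton ℂ V w).coprod (LinearMap.toSpanSingleton ℂ V w')
  have hφ₀ : ∀ s t, φ₀ (s, t) = s • w + t • w' := fun s t => by simp [φ₀]
  have hCφ : ∀ s t, C (φ₀ (s, t)) = φ₀ (a * s, -(a * t)) := fun s t => by
    rw [hφ₀, hφ₀, map_add, map_smul, map_smul, hCw, hCw']
    module
  have hinj : Function.Injective φ₀ := by
    rw [injective_iff_map_eq_zero]
    rintro ⟨s, t⟩ h
    have h' := hCφ s t
    rw [h, map_zero, hφ₀] at h'
    rw [hφ₀] at h
    have h1 : (2 * a * s) • w = 0 := by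
      linear_combination (norm := module) a • h - h'
    have h2 : (2 * a * t) • w' = 0 := by
      linear_combination (norm := module) a • h + h'
    have h3 := (smul_eq_zero.1 h1).resolve_right hw0
    have h4 := (smul_eq_zero.1 h2).resolve_right hw0'
    simp only [mul_eq_zero, OfNat.ofNat_ne_zero, ha, false_or] at h3 h4
    rw [h3, h4]
    rfl
  have hle : LinearMap.range φ₀ ≤ LinearMap.range C := by
    rintro _ ⟨⟨s, t⟩, rfl⟩
    refine ⟨φ₀ (a⁻¹ * s, -(a⁻¹ * t)), ?_⟩
    rw [hCφ]
    congr 2 <;> field_simp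
  have heq : LinearMap.range φ₀ = LinearMap.range C := by
    refine Submodule.eq_of_le_of_finrank_le hle ?_
    rw [LinearMap.finrank_range_of_inj hinj]
    simpa using hr
  refine ⟨(LinearEquiv.ofInjective φ₀ hinj).trans (LinearEquiv.ofEq _ _ heq), fun s t => ?_⟩
  exact hCφ s t

/-- The ranks of successive powers drop strictly until they reach zero. -/
theorem pow_three_eq_zero_of_isNilpotent {C : Module.End ℂ V} (h : IsNilpotent C)
    (hr : Module.finrank ℂ (LinearMap.range C) ≤ 2) : C ^ 3 = 0 := by
  by_contra h3
  have h2 : C ^ 2 ≠ 0 := fun h => h3 (by rw [pow_succ, h, zero_mul])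
  have h1 : C ^ 1 ≠ 0 := fun h => h2 (by rw [pow_succ, h, zero_mul])
  have l1 : _ < Module.finrank ℂ (LinearMap.range (C ^ 1)) := finrank_range_pow_succ_lt h h1
  have l2 : Module.finrank ℂ (LinearMap.range (C ^ 3)) < _ := finrank_range_pow_succ_lt h h2
  have l3 := finrank_range_pow_succ_lt h h3
  rw [pow_one] at l1
  change Module.finrank ℂ (LinearMap.range (C ^ 2)) < _ at l1
  omega

/-- If `C` has a nonzero eigenvalue and rank at most two, then `C` and `C ^ 2` have equal rank. -/
theorem finrank_range_sq_of_hasEigenvalue {β : BilinForm ℂ V} (hn : β.Nondegenerate)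
    {C : Module.End ℂ V} (hC : ∀ x y, β (C x) y = -β x (C y))
    (hr : Module.finrank ℂ (LinearMap.range C) ≤ 2) {a : ℂ} (ha : a ≠ 0)
    (hCa : C.HasEigenvalue a) :
    Module.finrank ℂ (LinearMap.range (C ^ 2)) = Module.finrank ℂ (LinearMap.range C) := by
  obtain ⟨φ, hφ⟩ := exists_equiv_range_of_hasEigenvalue hn hC hr ha hCa
  suffices h : LinearMap.range (C ^ 2) = LinearMap.range C by rw [h]
  refine le_antisymm (by rw [sq]; exact LinearMap.range_comp_le_range _ _) ?_
  intro x hx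
  obtain ⟨⟨s, t⟩, h⟩ := φ.surjective ⟨x, hx⟩
  obtain ⟨y, hy⟩ := (φ (a⁻¹ * s, -(a⁻¹ * t))).2
  refine ⟨y, ?_⟩
  rw [sq, Module.End.mul_apply, hy, hφ]
  have : (a * (a⁻¹ * s), -(a * -(a⁻¹ * t))) = (s, t) := by
    congr 1 <;> field_simp
  rw [this, h]

/-- Skew-symmetric maps `C` of rank at most two are determined up to conjugation and scalars by
the ranks of `C` and `C ^ 2`. -/
theorem scalarConj_of_finrank_le_two {β : BilinForm ℂ V} (hn : β.Nondegenerate)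
    {β' : BilinForm ℂ V'} (hn' : β'.Nondegenerate)
    {C : Module.End ℂ V} (hC : ∀ x y, β (C x) y = -β x (C y))
    {C' : Module.End ℂ V'} (hC' : ∀ x y, β' (C' x) y = -β' x (C' y))
    (hdim : Module.finrank ℂ V = Module.finrank ℂ V')
    (hr : Module.finrank ℂ (LinearMap.range C) ≤ 2)
    (h1 : Module.finrank ℂ (LinearMap.range C) = Module.finrank ℂ (LinearMap.range C'))
    (h2 : Module.finrank ℂ (LinearMap.range (C ^ 2)) =
      Module.finrank ℂ (LinearMap.range (C' ^ 2))) :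
    ScalarConj C C' := by
  have hr' := h1 ▸ hr
  by_cases hE : ∃ a, a ≠ 0 ∧ C.HasEigenvalue a
  · obtain ⟨a, ha, hCa⟩ := hE
    have hsq := finrank_range_sq_of_hasEigenvalue hn hC hr ha hCa
    -- Equality of the ranks of `C'` and `C' ^ 2` excludes a nonzero nilpotent `C'`.
    have hE' : ∃ a, a ≠ 0 ∧ C'.HasEigenvalue a := by
      by_contra! hne
      have hnil : IsNilpotent C' := isNilpotent_of_eigenvalue_eq_zero fun a h => by
        by_contra ha
        exact hne a ha h
      have h0 : C' ^ 1 ≠ 0 := by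
        intro h0
        rw [pow_one] at h0
        have hC1 := ne_zero_of_hasEigenvalue ha hCa
        apply hC1
        rw [pow_one, ← LinearMap.range_eq_bot, ← Submodule.finrank_eq_zero (R := ℂ), h1, h0,
          LinearMap.range_zero, finrank_bot]
      have hlt := finrank_range_pow_succ_lt hnil h0
      rw [pow_one] at hlt
      change Module.finrank ℂ (LinearMap.range (C' ^ 2)) < _ at hlt
      omega
    obtain ⟨a', ha', hCa'⟩ := hE'
    obtain ⟨φ, hφ⟩ := exists_equiv_range_of_hasEigenvalue hn hC hr ha hCa
    obtain ⟨φ', hφ'⟩ := exists_equiv_range_of_hasEigenvalue hn' hC' hr' ha' hCa'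
    have hc : a / a' ≠ 0 := div_ne_zero ha ha'
    -- On their ranges the maps are `diag(a, -a)` and `diag(a', -a')`, hence proportional with ratio
    -- `a / a'`; the conjugacy then extends from the ranges to the whole spaces.
    refine ⟨a / a', hc, ?_⟩
    refine exists_conj_of_range hdim C ((a / a') • C')
      ((φ.symm.trans φ').trans (LinearEquiv.ofEq _ _ (LinearMap.range_smul C' _ hc).symm)) ?_
    intro x
    obtain ⟨⟨s, t⟩, rfl⟩ := φ.surjective x
    have h3 : C.rangeRestrict (φ (s, t)) = φ (a * s, -(a * t)) := Subtype.ext (hφ s t)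
    rw [h3]
    simp only [LinearEquiv.trans_apply, LinearEquiv.symm_apply_apply, LinearEquiv.coe_ofEq_apply,
      LinearMap.smul_apply]
    rw [hφ', ← Submodule.coe_smul, ← map_smul]
    congr 2
    simp only [Prod.smul_mk, smul_eq_mul, Prod.mk.injEq]
    constructor <;> field_simp
  · have hnil : IsNilpotent C := isNilpotent_of_eigenvalue_eq_zero fun a h => by
      by_contra ha
      exact hE ⟨a, ha, h⟩
    have hnil' : IsNilpotent C' := isNilpotent_of_eigenvalue_eq_zero fun a h => by
      by_contra ha
      have hsq := finrank_range_sq_of_hasEigenvalue hn' hC' hr' ha h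
      have h0 : C ^ 1 ≠ 0 := by
        intro h0
        rw [pow_one] at h0
        have hC1 := ne_zero_of_hasEigenvalue ha h
        apply hC1
        rw [pow_one, ← LinearMap.range_eq_bot, ← Submodule.finrank_eq_zero (R := ℂ), ← h1, h0,
          LinearMap.range_zero, finrank_bot]
      have hlt := finrank_range_pow_succ_lt hnil h0
      rw [pow_one] at hlt
      change Module.finrank ℂ (LinearMap.range (C ^ 2)) < _ at hlt
      omega
    refine ⟨1, one_ne_zero, ?_⟩
    simp only [one_smul]
    refine exists_conj_of_isNilpotent hnil hnil' fun j => ?_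
    have h3 := pow_three_eq_zero_of_isNilpotent hnil hr
    have h3' := pow_three_eq_zero_of_isNilpotent hnil' hr'
    match j with
    | 0 =>
      rw [pow_zero, pow_zero, Module.End.one_eq_id, Module.End.one_eq_id, LinearMap.range_id,
        LinearMap.range_id, finrank_top, finrank_top, hdim]
    | 1 => rw [pow_one, pow_one, h1]
    | 2 => exact h2
    | j + 3 =>
      rw [pow_add, pow_add, h3, h3', mul_zero, mul_zero, LinearMap.range_zero, LinearMap.range_zero,
        finrank_bot, finrank_bot]

end SkewMaps

/-! ### Fitting decomposition of a skew-symmetric map -/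

section Fitting

variable {V : Type*} [AddCommGroup V] [Module ℂ V]
  {V' : Type*} [AddCommGroup V'] [Module ℂ V']

/-- The Fitting null component of an endomorphism. -/
def fittingNull (C : Module.End ℂ V) : Submodule ℂ V := ⨆ k : ℕ, LinearMap.ker (C ^ k)

/-- The Fitting one component of an endomorphism. -/
def fittingOne (C : Module.End ℂ V) : Submodule ℂ V := ⨅ k : ℕ, LinearMap.range (C ^ k)

theorem exists_fitting_eq [Module.Finite ℂ V] (C : Module.End ℂ V) :
    ∃ n, ∀ m ≥ n, fittingNull C = LinearMap.ker (C ^ m) ∧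
      fittingOne C = LinearMap.range (C ^ m) :=
  Filter.eventually_atTop.1
    ((LinearMap.eventually_iSup_ker_pow_eq C).and (LinearMap.eventually_iInf_range_pow_eq C))

theorem isCompl_fitting [Module.Finite ℂ V] (C : Module.End ℂ V) :
    IsCompl (fittingNull C) (fittingOne C) :=
  LinearMap.isCompl_iSup_ker_pow_iInf_range_pow C

theorem isNilpotent_restrict_fittingNull [Module.Finite ℂ V] (C : Module.End ℂ V)
    (h : ∀ x ∈ fittingNull C, C x ∈ fittingNull C) : IsNilpotent (C.restrict h) := by
  obtain ⟨n, hn⟩ := exists_fitting_eq C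
  refine ⟨n, LinearMap.ext fun x => Subtype.ext ?_⟩
  have hx : (x : V) ∈ LinearMap.ker (C ^ n) := (hn n le_rfl).1 ▸ x.2
  rw [Module.End.pow_restrict]
  exact hx

theorem skew_pow {β : BilinForm ℂ V} {C : Module.End ℂ V}
    (hC : ∀ x y, β (C x) y = -β x (C y)) (n : ℕ) (x y : V) :
    β ((C ^ n) x) y = (-1) ^ n * β x ((C ^ n) y) := by
  induction n generalizing x y with
  | zero => simp
  | succ n ih =>
    rw [pow_succ, Module.End.mul_apply, ih, hC, ← Module.End.mul_apply, ← pow_succ', ← pow_succ]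
    ring

/-- For large `n`, write `y = C ^ n z` and move `C ^ n` over to `x`, which it kills. -/
theorem fitting_ortho [Module.Finite ℂ V] {β : BilinForm ℂ V} {C : Module.End ℂ V}
    (hC : ∀ x y, β (C x) y = -β x (C y)) {x y : V} (hx : x ∈ fittingNull C)
    (hy : y ∈ fittingOne C) : β x y = 0 := by
  obtain ⟨n, hn⟩ := exists_fitting_eq C
  rw [(hn n le_rfl).1, LinearMap.mem_ker] at hx
  rw [(hn n le_rfl).2] at hy
  obtain ⟨z, rfl⟩ := hy
  have h := skew_pow hC n x z
  rw [hx, map_zero, LinearMap.zero_apply] at h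
  have h1 : ((-1 : ℂ) ^ n) ≠ 0 := pow_ne_zero _ (by norm_num)
  exact (mul_eq_zero.1 h.symm).resolve_left h1

/-- Used both for `𝔮` in `𝔤` and for the Fitting components in `𝔮`. -/
theorem nondegenerate_domRestrict_of_isCompl {β : BilinForm ℂ V} (hs : ∀ x y, β x y = β y x)
    (hn : β.Nondegenerate) {p q : Submodule ℂ V} (hpq : IsCompl p q)
    (ho : ∀ x ∈ p, ∀ y ∈ q, β x y = 0) :
    (β.domRestrict₁₂ p p : BilinForm ℂ p).Nondegenerate := by
  have key : ∀ x : p, (∀ y : p, β x y = 0) → x = 0 := by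
    intro x hx
    refine Subtype.ext (hn.1 _ fun z => ?_)
    have hz : z ∈ p ⊔ q := by rw [hpq.sup_eq_top]; trivial
    obtain ⟨u, hu, v, hv, rfl⟩ := Submodule.mem_sup.1 hz
    rw [map_add, ho x x.2 v hv, hx ⟨u, hu⟩, add_zero]
  exact ⟨fun x hx => key x hx, fun x hx => key x fun y => by rw [hs]; exact hx y⟩

theorem conj_pow {C : Module.End ℂ V} {C' : Module.End ℂ V'} {c : ℂ} {P : V ≃ₗ[ℂ] V'}
    (hP : ∀ x, P (C x) = c • C' (P x)) (n : ℕ) (x : V) :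
    P ((C ^ n) x) = c ^ n • (C' ^ n) (P x) := by
  induction n generalizing x with
  | zero => simp
  | succ n ih =>
    rw [pow_succ, Module.End.mul_apply, ih, hP, map_smul, pow_succ, pow_succ, mul_smul,
      Module.End.mul_apply]

/-- Conjugacy up to scalars can be checked on the Fitting components. -/
theorem scalarConj_iff_fitting [Module.Finite ℂ V] [Module.Finite ℂ V']
    (C : Module.End ℂ V) (C' : Module.End ℂ V')
    (hN : ∀ x ∈ fittingNull C, C x ∈ fittingNull C) (hI : ∀ x ∈ fittingOne C, C x ∈ fittingOne C)
    (hN' : ∀ x ∈ fittingNull C', C' x ∈ fittingNull C')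
    (hI' : ∀ x ∈ fittingOne C', C' x ∈ fittingOne C') :
    ScalarConj C C' ↔
      ScalarConj (C.restrict hN) (C'.restrict hN') ∧
        ScalarConj (C.restrict hI) (C'.restrict hI') := by
  constructor
  · rintro ⟨c, hc, P, hP⟩
    obtain ⟨n, hn⟩ := exists_fitting_eq C
    obtain ⟨n', hn'⟩ := exists_fitting_eq C'
    have hm := hn (max n n') (le_max_left _ _)
    have hm' := hn' (max n n') (le_max_right _ _)
    generalize max n n' = m at hm hm'
    have hpow := conj_pow hP m
    have hcm : c ^ m ≠ 0 := pow_ne_zero _ hc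
    have hmapN : (fittingNull C).map (P : V →ₗ[ℂ] V') = fittingNull C' := by
      rw [hm.1, hm'.1]
      ext y
      constructor
      · rintro ⟨x, hx, rfl⟩
        have h := hpow x
        rw [SetLike.mem_coe, LinearMap.mem_ker] at hx
        rw [hx, map_zero] at h
        exact (smul_eq_zero.1 h.symm).resolve_left hcm
      · intro hy
        refine ⟨P.symm y, ?_, by simp⟩
        rw [SetLike.mem_coe, LinearMap.mem_ker]
        have h := hpow (P.symm y)
        rw [LinearEquiv.apply_symm_apply, LinearMap.mem_ker.1 hy, smul_zero] at h
        simpa using h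
    have hmapI : (fittingOne C).map (P : V →ₗ[ℂ] V') = fittingOne C' := by
      rw [hm.2, hm'.2]
      ext y
      constructor
      · rintro ⟨_, ⟨x, rfl⟩, rfl⟩
        refine ⟨c ^ m • P x, ?_⟩
        rw [map_smul]
        exact (hpow x).symm
      · rintro ⟨z, rfl⟩
        refine ⟨(C ^ m) ((c ^ m)⁻¹ • P.symm z), ⟨_, rfl⟩, ?_⟩
        have h := hpow (P.symm z)
        rw [LinearEquiv.apply_symm_apply] at h
        change P _ = _
        rw [map_smul, map_smul, h, inv_smul_smul₀ hcm]
    refine ⟨⟨c, hc, (P.submoduleMap _).trans (LinearEquiv.ofEq _ _ hmapN), ?_⟩,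
      ⟨c, hc, (P.submoduleMap _).trans (LinearEquiv.ofEq _ _ hmapI), ?_⟩⟩
    · exact fun x => Subtype.ext (hP x)
    · exact fun x => Subtype.ext (hP x)
  · rintro ⟨⟨c, hc, P, hP⟩, ⟨d, hd, Q, hQ⟩⟩
    -- The scalar `c` of the nilpotent part is changed into the scalar `d` of the invertible part,
    -- whose scalar cannot be chosen freely.
    obtain ⟨R, hR⟩ := exists_conj_smul_of_isNilpotent (isNilpotent_restrict_fittingNull C hN)
      (div_ne_zero hd hc)
    have hRP : ∀ x, (R.trans P) (C.restrict hN x) = d • C'.restrict hN' ((R.trans P) x) := by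
      intro x
      rw [LinearEquiv.trans_apply, LinearEquiv.trans_apply, hR, map_smul, hP, smul_smul,
        div_mul_cancel₀ _ hc]
    have hc1 := isCompl_fitting C
    have hc2 := isCompl_fitting C'
    let e := Submodule.prodEquivOfIsCompl _ _ hc1
    let e' := Submodule.prodEquivOfIsCompl _ _ hc2
    have he : ∀ u, e u = (u.1 : V) + u.2 := fun u => rfl
    have he' : ∀ u, e' u = (u.1 : V') + u.2 := fun u => rfl
    let Φ := (R.trans P).prodCongr Q
    refine ⟨d, hd, e.symm.trans (Φ.trans e'), fun x => ?_⟩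
    obtain ⟨⟨u, v⟩, rfl⟩ := e.surjective x
    have h1 : C (e (u, v)) = e (C.restrict hN u, C.restrict hI v) := by
      rw [he, he, map_add]
      rfl
    rw [h1]
    change e' (Φ (e.symm (e _))) = d • C' (e' (Φ (e.symm (e _))))
    rw [LinearEquiv.symm_apply_apply, LinearEquiv.symm_apply_apply]
    rw [he', he', map_add, smul_add]
    exact congrArg₂ (· + ·) (congrArg Subtype.val (hRP u)) (congrArg Subtype.val (hQ v))

end Fitting

/-! ### Isomorphisms between double extensions -/

section Models

variable {V : Type*} [AddCommGroup V] [Module ℂ V] {V' : Type*} [AddCommGroup V'] [Module ℂ V']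

/-- The bracket of the double extension of `V` by `C`, on `V × ℂ × ℂ`, where `(x, a, b)` stands for
`x + a X₀ + b Y₀`. -/
def extBracket (β : BilinForm ℂ V) (C : V →ₗ[ℂ] V) :
    (V × ℂ × ℂ) →ₗ[ℂ] (V × ℂ × ℂ) →ₗ[ℂ] (V × ℂ × ℂ) :=
  LinearMap.mk₂ ℂ (fun u v => (u.2.2 • C v.1 - v.2.2 • C u.1, β (C u.1) v.1, 0))
    (fun u u' v => by
      ext
      · simp only [Prod.fst_add, Prod.snd_add, map_add]; module
      · simp
      · simp)
    (fun c u v => by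
      ext
      · simp only [Prod.smul_fst, Prod.smul_snd, map_smul, smul_eq_mul]; module
      · simp
      · simp)
    (fun u v v' => by
      ext
      · simp only [Prod.fst_add, Prod.snd_add, map_add]; module
      · simp
      · simp)
    (fun c u v => by
      ext
      · simp only [Prod.smul_fst, Prod.smul_snd, map_smul, smul_eq_mul]; module
      · simp
      · simp)

theorem extBracket_apply (β : BilinForm ℂ V) (C : V →ₗ[ℂ] V) (u v : V × ℂ × ℂ) :
    extBracket β C u v = (u.2.2 • C v.1 - v.2.2 • C u.1, β (C u.1) v.1, 0) := rfl

/-- The span of the brackets. -/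
def derivedSpan (β : BilinForm ℂ V) (C : V →ₗ[ℂ] V) : Submodule ℂ (V × ℂ × ℂ) :=
  Submodule.span ℂ {w | ∃ u v, extBracket β C u v = w}

/-- The sum of a subspace of `V` and the line `ℂ X₀`. -/
def addLine (p : Submodule ℂ V) : Submodule ℂ (V × ℂ × ℂ) := p.prod (Submodule.prod ⊤ ⊥)

theorem mem_addLine {p : Submodule ℂ V} {u : V × ℂ × ℂ} :
    u ∈ addLine p ↔ u.1 ∈ p ∧ u.2.2 = 0 := by
  simp [addLine, Submodule.mem_prod]

theorem finrank_addLine [Module.Finite ℂ V] (p : Submodule ℂ V) :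
    Module.finrank ℂ (addLine p) = Module.finrank ℂ p + 1 := by
  let j : (p × ℂ) →ₗ[ℂ] (V × ℂ × ℂ) :=
    (p.subtype ∘ₗ LinearMap.fst ℂ p ℂ).prod ((LinearMap.snd ℂ p ℂ).prod 0)
  have hj : Function.Injective j := by
    rintro ⟨x, a⟩ ⟨y, b⟩ h
    exact Prod.ext (Subtype.ext (congrArg Prod.fst h)) (congrArg (fun u => u.2.1) h)
  have hr : LinearMap.range j = addLine p := by
    ext ⟨x, a, b⟩
    rw [mem_addLine]
    constructor
    · rintro ⟨⟨y, c⟩, h⟩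
      rw [← h]
      exact ⟨y.2, rfl⟩
    · rintro ⟨h1, h2⟩
      exact ⟨(⟨x, h1⟩, a), Prod.ext rfl (Prod.ext rfl h2.symm)⟩
  rw [← hr, LinearMap.finrank_range_of_inj hj, Module.finrank_prod, Module.finrank_self]

theorem exists_apply_eq_one {β : BilinForm ℂ V} (hn : β.Nondegenerate) {x : V} (hx : x ≠ 0) :
    ∃ y, β x y = 1 := by
  have : ∃ y, β x y ≠ 0 := by
    by_contra! h
    exact hx (hn.1 x h)
  obtain ⟨y, hy⟩ := this
  exact ⟨(β x y)⁻¹ • y, by rw [map_smul, smul_eq_mul, inv_mul_cancel₀ hy]⟩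

/-- Brackets with `Y₀` give the range of `C`. As `C ≠ 0` and the form is nondegenerate, `X₀` itself
is a bracket of two vectors of `V`. -/
theorem derivedSpan_eq {β : BilinForm ℂ V} (hn : β.Nondegenerate) {C : V →ₗ[ℂ] V} (hC : C ≠ 0) :
    derivedSpan β C = addLine (LinearMap.range C) := by
  apply le_antisymm
  · refine Submodule.span_le.2 ?_
    rintro _ ⟨u, v, rfl⟩
    rw [SetLike.mem_coe, mem_addLine]
    exact ⟨⟨u.2.2 • v.1 - v.2.2 • u.1, by simp [extBracket_apply]⟩, rfl⟩
  · rintro ⟨x, a, b⟩ h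
    rw [mem_addLine] at h
    obtain ⟨⟨y, hy⟩, hb⟩ := h
    simp only at hy hb
    have h1 : ((0, 1, 0) : V × ℂ × ℂ) ∈ derivedSpan β C := by
      have : ∃ z, C z ≠ 0 := by
        by_contra! h
        exact hC (LinearMap.ext h)
      obtain ⟨z, hz⟩ := this
      obtain ⟨w, hw⟩ := exists_apply_eq_one hn hz
      exact Submodule.subset_span ⟨(z, 0, 0), (w, 0, 0), by simp [extBracket_apply, hw]⟩
    have h2 : ((x, 0, 0) : V × ℂ × ℂ) ∈ derivedSpan β C :=
      Submodule.subset_span ⟨(0, 0, 1), (y, 0, 0), by simp [extBracket_apply, hy]⟩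
    have h3 : ((x, a, b) : V × ℂ × ℂ) = (x, 0, 0) + a • (0, 1, 0) := by simp [hb]
    rw [h3]
    exact Submodule.add_mem _ h2 (Submodule.smul_mem _ _ h1)

/-- For a vector without `Y₀`-component, being central amounts to commuting with `Y₀`, that is, to
having its `V`-component in `ker C`. -/
theorem derivedSpan_inf_ker {β : BilinForm ℂ V} (hn : β.Nondegenerate) {C : V →ₗ[ℂ] V}
    (hC : C ≠ 0) :
    derivedSpan β C ⊓ LinearMap.ker (extBracket β C) =
      addLine (LinearMap.range C ⊓ LinearMap.ker C) := by
  rw [derivedSpan_eq hn hC]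
  ext ⟨x, a, b⟩
  simp only [Submodule.mem_inf, mem_addLine, LinearMap.mem_ker]
  constructor
  · rintro ⟨⟨h1, h2⟩, h3⟩
    have h4 := congrArg Prod.fst (LinearMap.congr_fun h3 (0, 0, 1))
    refine ⟨⟨h1, ?_⟩, h2⟩
    simpa [extBracket_apply] using h4
  · rintro ⟨⟨h1, h3⟩, h2⟩
    refine ⟨⟨h1, h2⟩, LinearMap.ext fun v => ?_⟩
    simp [extBracket_apply, h3, h2]

section Bracket

variable {β : BilinForm ℂ V} {β' : BilinForm ℂ V'} {C : V →ₗ[ℂ] V} {C' : V' →ₗ[ℂ] V'}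

theorem map_derivedSpan (A : (V × ℂ × ℂ) ≃ₗ[ℂ] (V' × ℂ × ℂ))
    (hA : ∀ u v, A (extBracket β C u v) = extBracket β' C' (A u) (A v)) :
    (derivedSpan β C).map (A : (V × ℂ × ℂ) →ₗ[ℂ] (V' × ℂ × ℂ)) = derivedSpan β' C' := by
  rw [derivedSpan, Submodule.map_span, derivedSpan]
  congr 1
  ext w
  constructor
  · rintro ⟨_, ⟨u, v, rfl⟩, rfl⟩
    exact ⟨A u, A v, (hA u v).symm⟩
  · rintro ⟨u, v, rfl⟩
    refine ⟨_, ⟨A.symm u, A.symm v, rfl⟩, ?_⟩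
    change A _ = _
    rw [hA, A.apply_symm_apply, A.apply_symm_apply]

theorem map_ker_extBracket (A : (V × ℂ × ℂ) ≃ₗ[ℂ] (V' × ℂ × ℂ))
    (hA : ∀ u v, A (extBracket β C u v) = extBracket β' C' (A u) (A v)) :
    (LinearMap.ker (extBracket β C)).map (A : (V × ℂ × ℂ) →ₗ[ℂ] (V' × ℂ × ℂ)) =
      LinearMap.ker (extBracket β' C') := by
  ext w
  constructor
  · rintro ⟨u, hu, rfl⟩
    refine LinearMap.ext fun v => ?_
    obtain ⟨v, rfl⟩ := A.surjective v
    change extBracket β' C' (A u) (A v) = 0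
    rw [← hA, LinearMap.mem_ker.1 hu, LinearMap.zero_apply, map_zero]
  · intro hw
    refine ⟨A.symm w, LinearMap.ext fun v => A.injective ?_, A.apply_symm_apply w⟩
    rw [hA, A.apply_symm_apply, LinearMap.mem_ker.1 hw]
    simp

theorem eq_zero_of_eq_zero (A : (V × ℂ × ℂ) ≃ₗ[ℂ] (V' × ℂ × ℂ))
    (hA : ∀ u v, A (extBracket β C u v) = extBracket β' C' (A u) (A v))
    (h : C = 0) : C' = 0 := by
  ext x
  have h1 := hA (A.symm (0, 0, 1)) (A.symm (x, 0, 0))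
  rw [A.apply_symm_apply, A.apply_symm_apply] at h1
  have h2 := congrArg Prod.fst h1
  have h3 : ∀ u v, extBracket β C u v = 0 := fun u v => by simp [extBracket_apply, h]
  rw [h3, map_zero] at h2
  simpa [extBracket_apply] using h2.symm

end Bracket

theorem finrank_eq_of_bracket [Module.Finite ℂ V] [Module.Finite ℂ V']
    (A : (V × ℂ × ℂ) ≃ₗ[ℂ] (V' × ℂ × ℂ)) : Module.finrank ℂ V = Module.finrank ℂ V' := by
  have h := A.finrank_eq
  simp only [Module.finrank_prod, Module.finrank_self] at h
  omega

/-- The vectors `u` outside of `V ⊕ ℂ X₀` are detected by the rank of their adjoint action. -/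
theorem finrank_range_extBracket_le_two_iff [Module.Finite ℂ V] {β : BilinForm ℂ V}
    {C : V →ₗ[ℂ] V} (hr : 2 < Module.finrank ℂ (LinearMap.range C)) (u : V × ℂ × ℂ) :
    Module.finrank ℂ (LinearMap.range (extBracket β C u)) ≤ 2 ↔ u.2.2 = 0 := by
  constructor
  · intro h
    by_contra hb
    have h1 : LinearMap.range C ≤
        (LinearMap.range (extBracket β C u)).map (LinearMap.fst ℂ V (ℂ × ℂ)) := by
      rintro _ ⟨x, rfl⟩
      refine ⟨_, ⟨(u.2.2⁻¹ • x, 0, 0), rfl⟩, ?_⟩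
      simp [extBracket_apply, hb]
    have h2 := Submodule.finrank_mono h1
    have h3 := Submodule.finrank_map_le (LinearMap.fst ℂ V (ℂ × ℂ))
      (LinearMap.range (extBracket β C u))
    omega
  · intro hb
    have h1 : LinearMap.range (extBracket β C u) ≤ addLine (Submodule.span ℂ {C u.1}) := by
      rintro _ ⟨v, rfl⟩
      rw [mem_addLine]
      refine ⟨?_, rfl⟩
      rw [Submodule.mem_span_singleton]
      exact ⟨-v.2.2, by simp [extBracket_apply, hb]⟩
    have h2 := Submodule.finrank_mono h1
    rw [finrank_addLine] at h2
    have h3 := finrank_span_le_card (R := ℂ) ({C u.1} : Set V)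
    rw [Set.toFinset_card, Fintype.card_unique] at h3
    omega

theorem scalarConj_of_two_lt_finrank [Module.Finite ℂ V] [Module.Finite ℂ V']
    {β : BilinForm ℂ V} {β' : BilinForm ℂ V'} {C : V →ₗ[ℂ] V} {C' : V' →ₗ[ℂ] V'}
    (hn : β.Nondegenerate)
    (A : (V × ℂ × ℂ) ≃ₗ[ℂ] (V' × ℂ × ℂ))
    (hA : ∀ u v, A (extBracket β C u v) = extBracket β' C' (A u) (A v))
    (hr : 2 < Module.finrank ℂ (LinearMap.range C))
    (hr' : 2 < Module.finrank ℂ (LinearMap.range C')) : ScalarConj C C' := by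
  have hpres : ∀ u, (A u).2.2 = 0 ↔ u.2.2 = 0 := by
    intro u
    rw [← finrank_range_extBracket_le_two_iff (β := β) hr u,
      ← finrank_range_extBracket_le_two_iff (β := β') hr' (A u)]
    have : extBracket β' C' (A u) ∘ₗ (A : (V × ℂ × ℂ) →ₗ[ℂ] (V' × ℂ × ℂ)) =
        (A : (V × ℂ × ℂ) →ₗ[ℂ] (V' × ℂ × ℂ)) ∘ₗ extBracket β C u :=
      LinearMap.ext fun v => (hA u v).symm
    have h1 := congrArg LinearMap.range this
    rw [LinearMap.range_comp_of_range_eq_top _ A.range, LinearMap.range_comp] at h1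
    rw [h1, LinearEquiv.finrank_map_eq]
  have hC : ∃ z, C z ≠ 0 := by
    by_contra! h
    rw [show C = 0 from LinearMap.ext h, LinearMap.range_zero, finrank_bot] at hr
    omega
  obtain ⟨z, hz⟩ := hC
  obtain ⟨w, hw⟩ := exists_apply_eq_one hn hz
  -- `X₀ = [z, w]` is sent to a bracket of two vectors without `Y₀`-component, hence to a multiple
  -- of the new `X₀`.
  have hX : A (0, 1, 0) = (0, β' (C' (A (z, 0, 0)).1) (A (w, 0, 0)).1, 0) := by
    have h1 := hA (z, 0, 0) (w, 0, 0)
    rw [extBracket_apply β', (hpres (z, 0, 0)).2 rfl, (hpres (w, 0, 0)).2 rfl] at h1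
    simpa [extBracket_apply, hw] using h1
  set c := β' (C' (A (z, 0, 0)).1) (A (w, 0, 0)).1
  have hc : c ≠ 0 := by
    intro h
    rw [h] at hX
    have h1 : ((0, 1, 0) : V × ℂ × ℂ) = 0 := (LinearEquiv.map_eq_zero_iff A).1 hX
    have h2 : (1 : ℂ) = 0 := congrArg (fun u => u.2.1) h1
    exact one_ne_zero h2
  let P : V →ₗ[ℂ] V' := LinearMap.fst ℂ V' (ℂ × ℂ) ∘ₗ
    (A : (V × ℂ × ℂ) →ₗ[ℂ] (V' × ℂ × ℂ)) ∘ₗ LinearMap.inl ℂ V (ℂ × ℂ)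
  have hP : ∀ x, P x = (A (x, 0, 0)).1 := fun x => rfl
  have hinj : Function.Injective P := by
    rw [injective_iff_map_eq_zero]
    intro x hx
    rw [hP] at hx
    have h1 : A (x, 0, 0) = A (((A (x, 0, 0)).2.1 / c) • (0, 1, 0)) := by
      rw [map_smul, hX]
      refine Prod.ext ?_ (Prod.ext ?_ ?_)
      · simp [hx]
      · simp [hc]
      · simpa using (hpres (x, 0, 0)).2 rfl
    have h2 := congrArg Prod.fst (A.injective h1)
    simpa using h2
  -- The scalar is the `Y₀`-coefficient of the image of `Y₀`: the conjugacy comes from applying `A`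
  -- to `[Y₀, x] = C x`.
  refine ⟨(A (0, 0, 1)).2.2, fun h => one_ne_zero ((hpres (0, 0, 1)).1 h),
    LinearEquiv.ofInjectiveOfFinrankEq P hinj (finrank_eq_of_bracket A), fun x => ?_⟩
  change P (C x) = _ • C' (P x)
  have h1 := congrArg Prod.fst (hA (0, 0, 1) (x, 0, 0))
  rw [extBracket_apply β', (hpres (x, 0, 0)).2 rfl] at h1
  simpa [extBracket_apply, hP] using h1

/-- An isomorphism between double extensions makes the skew-symmetric maps conjugate up to a
scalar. -/
theorem scalarConj_of_extBracket [Module.Finite ℂ V] [Module.Finite ℂ V']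
    {β : BilinForm ℂ V} {β' : BilinForm ℂ V'} {C : V →ₗ[ℂ] V} {C' : V' →ₗ[ℂ] V'}
    (hn : β.Nondegenerate) (hn' : β'.Nondegenerate)
    (hsk : ∀ x y, β (C x) y = -β x (C y)) (hsk' : ∀ x y, β' (C' x) y = -β' x (C' y))
    (A : (V × ℂ × ℂ) ≃ₗ[ℂ] (V' × ℂ × ℂ))
    (hA : ∀ u v, A (extBracket β C u v) = extBracket β' C' (A u) (A v)) :
    ScalarConj C C' := by
  have hdim := finrank_eq_of_bracket A
  -- The zero map must be allowed: a Fitting component of a non-Abelian algebra can be Abelian.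
  by_cases hC : C = 0
  · have hC' := eq_zero_of_eq_zero A hA hC
    exact ⟨1, one_ne_zero, LinearEquiv.ofFinrankEq _ _ hdim, fun x => by simp [hC, hC']⟩
  have hC' : C' ≠ 0 := fun h => hC (eq_zero_of_eq_zero (β := β') (β' := β) A.symm (fun u v => by
    apply A.injective
    rw [hA]
    simp) h)
  have h1 : Module.finrank ℂ (LinearMap.range C) = Module.finrank ℂ (LinearMap.range C') := by
    have h := LinearEquiv.finrank_map_eq A (derivedSpan β C)
    rw [map_derivedSpan A hA, derivedSpan_eq hn hC, derivedSpan_eq hn' hC', finrank_addLine,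
      finrank_addLine] at h
    omega
  by_cases hr : 2 < Module.finrank ℂ (LinearMap.range C)
  · exact scalarConj_of_two_lt_finrank hn A hA hr (h1 ▸ hr)
  · have hk := LinearEquiv.finrank_map_eq A (derivedSpan β C ⊓ LinearMap.ker (extBracket β C))
    rw [Submodule.map_inf _ A.injective, map_derivedSpan A hA, map_ker_extBracket A hA,
      derivedSpan_inf_ker hn hC, derivedSpan_inf_ker hn' hC', finrank_addLine,
      finrank_addLine] at hk
    have h2 := finrank_range_sq_add C
    have h2' := finrank_range_sq_add C'
    exact scalarConj_of_finrank_le_two hn hn' hsk hsk' hdim (by omega) h1 (by omega)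

/-- `e` identifies `(L, B)` with the double extension of `(V, β)` by `C`. -/
structure IsExtension {L : Type*} [LieRing L] [LieAlgebra ℂ L] (B : BilinForm ℂ L)
    (β : BilinForm ℂ V) (C : V →ₗ[ℂ] V) (e : (V × ℂ × ℂ) ≃ₗ[ℂ] L) : Prop where
  symm : ∀ x y, β x y = β y x
  nondegenerate : β.Nondegenerate
  skew : ∀ x y, β (C x) y = -β x (C y)
  lie : ∀ u v, ⁅e u, e v⁆ = e (extBracket β C u v)
  form : ∀ u v, B (e u) (e v) = β u.1 v.1 + u.2.1 * v.2.2 + u.2.2 * v.2.1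

variable {L L' : Type*} [LieRing L] [LieAlgebra ℂ L] [LieRing L'] [LieAlgebra ℂ L']
  {B : BilinForm ℂ L} {B' : BilinForm ℂ L'} {β : BilinForm ℂ V} {β' : BilinForm ℂ V'}
  {C : V →ₗ[ℂ] V} {C' : V' →ₗ[ℂ] V'} {e : (V × ℂ × ℂ) ≃ₗ[ℂ] L} {e' : (V' × ℂ × ℂ) ≃ₗ[ℂ] L'}

theorem IsExtension.scalarConj [Module.Finite ℂ V] [Module.Finite ℂ V']
    (h : IsExtension B β C e) (h' : IsExtension B' β' C' e') (hL : Isomorphic L L') :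
    ScalarConj C C' := by
  obtain ⟨A⟩ := hL
  refine scalarConj_of_extBracket h.nondegenerate h'.nondegenerate h.skew h'.skew
    (e.trans (A.toLinearEquiv.trans e'.symm)) fun u v => ?_
  apply e'.injective
  rw [← h'.lie]
  simp only [LinearEquiv.trans_apply, LinearEquiv.apply_symm_apply, LieEquiv.coe_toLinearEquiv]
  rw [← h.lie, LieEquiv.map_lie]

theorem IsExtension.iIsomorphic [Module.Finite ℂ V]
    (h : IsExtension B β C e) (h' : IsExtension B' β' C' e') (hC : ScalarConj C C') :
    IIsomorphic B B' := by
  obtain ⟨c, hc, P, hP⟩ := hC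
  obtain ⟨U, hU, hUβ⟩ := exists_isometry_of_conj h.symm h.nondegenerate h'.symm h'.nondegenerate
    h.skew (C' := c • C') (fun x y => by simp [h'.skew]) P hP
  -- Since `U` carries `C` to `c • C'`, `Y₀` must be multiplied by `c`; the factor `c⁻¹` on `X₀`
  -- then preserves both `B(X₀, Y₀) = 1` and the `X₀`-part of the bracket.
  let S : (V × ℂ × ℂ) ≃ₗ[ℂ] (V' × ℂ × ℂ) :=
    U.prodCongr ((LinearEquiv.smulOfNeZero ℂ ℂ c⁻¹ (inv_ne_zero hc)).prodCongr
      (LinearEquiv.smulOfNeZero ℂ ℂ c hc))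
  have hS : ∀ u, S u = (U u.1, c⁻¹ * u.2.1, c * u.2.2) := fun u => rfl
  let A₀ : L ≃ₗ[ℂ] L' := e.symm.trans (S.trans e')
  have hA₀ : ∀ u, A₀ (e u) = e' (S u) := fun u => by simp [A₀]
  have hlie : ∀ x y, A₀ ⁅x, y⁆ = ⁅A₀ x, A₀ y⁆ := by
    intro x y
    obtain ⟨u, rfl⟩ := e.surjective x
    obtain ⟨v, rfl⟩ := e.surjective y
    rw [h.lie, hA₀, hA₀, hA₀, h'.lie]
    congr 1
    rw [hS, hS, hS, extBracket_apply, extBracket_apply]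
    refine Prod.ext ?_ (Prod.ext ?_ ?_)
    · simp only [map_sub, map_smul, hU, LinearMap.smul_apply, smul_smul]
      module
    · have h1 := hUβ (C u.1) v.1
      rw [hU] at h1
      simp only [LinearMap.smul_apply, map_smul, smul_eq_mul] at h1 ⊢
      rw [← h1, inv_mul_cancel_left₀ hc]
    · simp
  refine ⟨{ A₀ with map_lie' := fun {x y} => hlie x y }, fun x y => ?_⟩
  obtain ⟨u, rfl⟩ := e.surjective x
  obtain ⟨v, rfl⟩ := e.surjective y
  change B' (A₀ (e u)) (A₀ (e v)) = _
  rw [hA₀, hA₀, h.form, h'.form, hS, hS, hUβ]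
  field_simp

theorem IIsomorphic.isomorphic (h : IIsomorphic B B') : Isomorphic L L' := ⟨h.choose⟩

theorem IsExtension.isomorphic_iff [Module.Finite ℂ V] [Module.Finite ℂ V']
    (h : IsExtension B β C e) (h' : IsExtension B' β' C' e') :
    Isomorphic L L' ↔ ScalarConj C C' :=
  ⟨h.scalarConj h', fun hC => (h.iIsomorphic h' hC).isomorphic⟩

theorem IsExtension.iIsomorphic_iff [Module.Finite ℂ V] [Module.Finite ℂ V']
    (h : IsExtension B β C e) (h' : IsExtension B' β' C' e') :
    IIsomorphic B B' ↔ ScalarConj C C' :=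
  ⟨fun hL => h.scalarConj h' hL.isomorphic, h.iIsomorphic h'⟩

end Models

/-! ### Realizations and their Fitting components as model double extensions -/

namespace DoubleExtension

variable {𝔤 : Type*} [LieRing 𝔤] [LieAlgebra ℂ 𝔤] {B : BilinForm ℂ 𝔤}

/-- The embedding `(x, a, b) ↦ x + a X₀ + b Y₀`. -/
def param (D : DoubleExtension B) : (D.𝔮 × ℂ × ℂ) →ₗ[ℂ] 𝔤 :=
  D.𝔮.subtype.coprod
    ((LinearMap.toSpanSingleton ℂ 𝔤 D.X₀).coprod (LinearMap.toSpanSingleton ℂ 𝔤 D.Y₀))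

theorem param_apply (D : DoubleExtension B) (u : D.𝔮 × ℂ × ℂ) :
    D.param u = (u.1 : 𝔤) + u.2.1 • D.X₀ + u.2.2 • D.Y₀ := by
  simp [param, add_assoc]

theorem param_form (D : DoubleExtension B) (hs : ∀ x y, B x y = B y x) (u v : D.𝔮 × ℂ × ℂ) :
    B (D.param u) (D.param v) = B u.1 v.1 + u.2.1 * v.2.2 + u.2.2 * v.2.1 := by
  have h1 := D.X₀_ortho u.1 u.1.2
  have h2 := D.X₀_ortho v.1 v.1.2
  have h3 := D.Y₀_ortho u.1 u.1.2
  have h4 := D.Y₀_ortho v.1 v.1.2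
  rw [hs] at h1 h3
  have h5 := D.X₀_Y₀
  rw [hs] at h5
  simp only [param_apply, map_add, map_smul, LinearMap.add_apply, LinearMap.smul_apply, smul_eq_mul,
    h1, h2, h3, h4, h5, D.X₀_Y₀, D.X₀_X₀, D.Y₀_Y₀]
  ring

theorem param_lie (D : DoubleExtension B) (u v : D.𝔮 × ℂ × ℂ) :
    ⁅D.param u, D.param v⁆ = D.param (extBracket (B.domRestrict₁₂ D.𝔮 D.𝔮) D.C u v) := by
  rw [param_apply, param_apply, D.lie_eq, param_apply, extBracket_apply]
  simp [LinearMap.domRestrict₁₂_apply]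

theorem param_injective (D : DoubleExtension B) (hs : ∀ x y, B x y = B y x) :
    Function.Injective D.param := by
  rw [injective_iff_map_eq_zero]
  rintro ⟨x, a, b⟩ h
  -- Pairing with `X₀` reads off `b`, pairing with `Y₀` reads off `a`.
  have h1 := D.param_form hs (x, a, b) (0, 1, 0)
  have h2 := D.param_form hs (x, a, b) (0, 0, 1)
  rw [h] at h1 h2
  have hb : b = 0 := by simpa using h1.symm
  have ha : a = 0 := by simpa using h2.symm
  rw [param_apply] at h
  subst ha hb
  have hx : x = 0 := by simpa using h
  rw [hx]
  rfl

theorem range_param (D : DoubleExtension B) : LinearMap.range D.param = ⊤ := by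
  rw [param, LinearMap.range_coprod, LinearMap.range_coprod, Submodule.range_subtype,
    LinearMap.range_toSpanSingleton, LinearMap.range_toSpanSingleton, ← Submodule.span_union,
    sup_comm, ← D.isCompl.sup_eq_top, Set.singleton_union]

theorem nondegenerate_restrict (D : DoubleExtension B) (hB : IsQuadratic B) :
    (B.domRestrict₁₂ D.𝔮 D.𝔮 : BilinForm ℂ D.𝔮).Nondegenerate := by
  refine nondegenerate_domRestrict_of_isCompl hB.symm hB.nondegenerate D.isCompl.symm ?_
  intro x hx y hy
  obtain ⟨a, b, rfl⟩ := Submodule.mem_span_pair.1 hy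
  rw [map_add, map_smul, map_smul, hB.symm x, hB.symm x, D.X₀_ortho x hx, D.Y₀_ortho x hx]
  simp

/-- `(x, a, b) ↦ x + a X₀ + b Y₀` as an equivalence. -/
def paramEquiv (D : DoubleExtension B) (hs : ∀ x y, B x y = B y x) :
    (D.𝔮 × ℂ × ℂ) ≃ₗ[ℂ] 𝔤 :=
  LinearEquiv.ofBijective D.param
    ⟨D.param_injective hs, LinearMap.range_eq_top.1 D.range_param⟩

theorem isExtension (D : DoubleExtension B) (hB : IsQuadratic B) :
    IsExtension B (B.domRestrict₁₂ D.𝔮 D.𝔮) D.C (D.paramEquiv hB.symm) where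
  symm x y := hB.symm x y
  nondegenerate := D.nondegenerate_restrict hB
  skew := D.skew
  lie := D.param_lie
  form := D.param_form hB.symm

/-- The embedding `(x, a, b) ↦ x + a X₀ + b Y₀` for `x` in a subspace `p` of `𝔮`. -/
def paramOn (D : DoubleExtension B) (p : Submodule ℂ D.𝔮) : (p × ℂ × ℂ) →ₗ[ℂ] 𝔤 :=
  D.param ∘ₗ p.subtype.prodMap LinearMap.id

theorem paramOn_apply (D : DoubleExtension B) (p : Submodule ℂ D.𝔮) (u : p × ℂ × ℂ) :
    D.paramOn p u = D.param (u.1, u.2) := rfl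

theorem range_paramOn (D : DoubleExtension B) (p : Submodule ℂ D.𝔮)
    (hp : ∀ x ∈ p, D.C x ∈ p) :
    LinearMap.range (D.paramOn p) = (D.extend p hp).toSubmodule := by
  have h : D.paramOn p = (D.𝔮.subtype ∘ₗ p.subtype).coprod
      ((LinearMap.toSpanSingleton ℂ 𝔤 D.X₀).coprod (LinearMap.toSpanSingleton ℂ 𝔤 D.Y₀)) := by
    refine LinearMap.ext fun u => ?_
    simp [paramOn_apply, param]
  change _ = Submodule.span ℂ {D.X₀, D.Y₀} ⊔ p.map D.𝔮.subtype
  rw [h, LinearMap.range_coprod, LinearMap.range_coprod, LinearMap.range_comp,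
    Submodule.range_subtype, LinearMap.range_toSpanSingleton, LinearMap.range_toSpanSingleton,
    ← Submodule.span_union, sup_comm, Set.singleton_union]

/-- The subalgebra `(ℂ X₀ ⊕ ℂ Y₀) ⊕ p` is the double extension of `p` by the restriction of
`C`. -/
theorem exists_isExtension_extend (D : DoubleExtension B) (hB : IsQuadratic B)
    (p : Submodule ℂ D.𝔮) (hp : ∀ x ∈ p, D.C x ∈ p) {β : BilinForm ℂ D.𝔮}
    (hβ : β = B.domRestrict₁₂ D.𝔮 D.𝔮)
    (hn : (β.domRestrict₁₂ p p : BilinForm ℂ p).Nondegenerate) :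
    ∃ e, IsExtension (restrictForm B (D.extend p hp)) (β.domRestrict₁₂ p p) (D.C.restrict hp) e := by
  subst hβ
  have hinj : Function.Injective (D.paramOn p) := by
    refine (D.param_injective hB.symm).comp ?_
    exact (Subtype.val_injective).prodMap Function.injective_id
  let e : (p × ℂ × ℂ) ≃ₗ[ℂ] D.extend p hp :=
    (LinearEquiv.ofInjective _ hinj).trans (LinearEquiv.ofEq _ _ (D.range_paramOn p hp))
  have he : ∀ u, (e u : 𝔤) = D.param (u.1, u.2) := fun u => rfl
  refine ⟨e, fun x y => hB.symm _ _, hn, fun x y => D.skew x y, fun u v => Subtype.ext ?_,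
    fun u v => ?_⟩
  · rw [LieSubalgebra.coe_bracket, he, he, param_lie, he]
    rfl
  · exact D.param_form hB.symm (u.1, u.2) (v.1, v.2)

variable {𝔤' : Type*} [LieRing 𝔤'] [LieAlgebra ℂ 𝔤'] {B' : BilinForm ℂ 𝔤'}

theorem exists_isExtension_gN [Module.Finite ℂ 𝔤] (D : DoubleExtension B) (hB : IsQuadratic B) :
    ∃ β e, IsExtension D.formN β (LinearMap.restrict D.C D.map_mem_qN) e := by
  have hn := nondegenerate_domRestrict_of_isCompl
    (β := (B.domRestrict₁₂ D.𝔮 D.𝔮 : BilinForm ℂ D.𝔮)) (fun x y => hB.symm x y)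
    (D.nondegenerate_restrict hB) (isCompl_fitting D.C)
    (fun x hx y hy => fitting_ortho
      (β := (B.domRestrict₁₂ D.𝔮 D.𝔮 : BilinForm ℂ D.𝔮)) D.skew hx hy)
  exact ⟨_, D.exists_isExtension_extend hB D.qN D.map_mem_qN rfl hn⟩

theorem exists_isExtension_gI [Module.Finite ℂ 𝔤] (D : DoubleExtension B) (hB : IsQuadratic B) :
    ∃ β e, IsExtension D.formI β (LinearMap.restrict D.C D.map_mem_qI) e := by
  have hn := nondegenerate_domRestrict_of_isCompl
    (β := (B.domRestrict₁₂ D.𝔮 D.𝔮 : BilinForm ℂ D.𝔮)) (fun x y => hB.symm x y)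
    (D.nondegenerate_restrict hB) (isCompl_fitting D.C).symm
    (fun x hx y hy => (hB.symm _ _).trans (fitting_ortho
      (β := (B.domRestrict₁₂ D.𝔮 D.𝔮 : BilinForm ℂ D.𝔮)) D.skew hy hx))
  exact ⟨_, D.exists_isExtension_extend hB D.qI D.map_mem_qI rfl hn⟩

theorem scalarConj_iff [Module.Finite ℂ 𝔤] [Module.Finite ℂ 𝔤'] (D : DoubleExtension B)
    (D' : DoubleExtension B') :
    ScalarConj D.C D'.C ↔
      ScalarConj (LinearMap.restrict D.C D.map_mem_qN) (LinearMap.restrict D'.C D'.map_mem_qN) ∧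
      ScalarConj (LinearMap.restrict D.C D.map_mem_qI) (LinearMap.restrict D'.C D'.map_mem_qI) :=
  scalarConj_iff_fitting D.C D'.C D.map_mem_qN D.map_mem_qI D'.map_mem_qN D'.map_mem_qI

end DoubleExtension

/-! ### Existence of a realization -/

section Existence

variable {𝔤 : Type*} [LieRing 𝔤] [LieAlgebra ℂ 𝔤] {B : BilinForm ℂ 𝔤}

theorem wedgeRight_threeForm_apply (hB : IsQuadratic B) (α : Module.Dual ℂ 𝔤) (x y z w : 𝔤) :
    wedgeRight (threeForm hB) α ![x, y, z, w] =
      α x * B ⁅y, z⁆ w - α y * B ⁅x, z⁆ w + α z * B ⁅x, y⁆ w - α w * B ⁅x, y⁆ z := by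
  have h3 : ∀ v, threeForm hB v = B ⁅v 0, v 1⁆ (v 2) := fun v => rfl
  simp [wedgeRight, AlternatingMap.alternatizeUncurryFin_apply, Fin.sum_univ_four, h3,
    Fin.removeNth, Fin.succAbove]
  ring

/-- The ideal of the vectors `X` with `B(X, ·) ∧ I = 0`. -/
def dupIdeal (hB : IsQuadratic B) : LieIdeal ℂ 𝔤 where
  carrier := {X | ∀ x y z w : 𝔤,
    B X x * B ⁅y, z⁆ w - B X y * B ⁅x, z⁆ w + B X z * B ⁅x, y⁆ w - B X w * B ⁅x, y⁆ z = 0}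
  add_mem' := by
    intro X Y hX hY x y z w
    simp only [map_add, LinearMap.add_apply]
    linear_combination hX x y z w + hY x y z w
  zero_mem' := by
    intro x y z w
    simp
  smul_mem' := by
    intro c X hX x y z w
    simp only [map_smul, LinearMap.smul_apply, smul_eq_mul]
    linear_combination c * hX x y z w
  lie_mem := by
    intro t X hX x y z w
    have hder : ∀ x y z : 𝔤, B ⁅⁅t, x⁆, y⁆ z + B ⁅x, ⁅t, y⁆⁆ z + B ⁅x, y⁆ ⁅t, z⁆ = 0 := by
      intro x y z
      have h1 : B ⁅x, y⁆ ⁅t, z⁆ = -B ⁅t, ⁅x, y⁆⁆ z := by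
        rw [← hB.invariant, ← lie_skew, map_neg, LinearMap.neg_apply]
      rw [h1, leibniz_lie t x y, map_add, LinearMap.add_apply]
      ring
    have hinv : ∀ x, B ⁅t, X⁆ x = -B X ⁅t, x⁆ := by
      intro x
      rw [← lie_skew, map_neg, LinearMap.neg_apply, hB.invariant]
    simp only [hinv]
    -- The 3-form is invariant under `ad t` (this is `hder`), so letting `t` act as a derivation on
    -- the identity for `X` gives the one for `⁅t, X⁆`.
    linear_combination -hX ⁅t, x⁆ y z w - hX x ⁅t, y⁆ z w - hX x y ⁅t, z⁆ w - hX x y z ⁅t, w⁆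
      + B X x * hder y z w - B X y * hder x z w + B X z * hder x y w - B X w * hder x y z

theorem mem_dupIdeal (hB : IsQuadratic B) {X : 𝔤} :
    X ∈ dupIdeal hB ↔ ∀ x y z w : 𝔤,
      B X x * B ⁅y, z⁆ w - B X y * B ⁅x, z⁆ w + B X z * B ⁅x, y⁆ w - B X w * B ⁅x, y⁆ z = 0 :=
  Iff.rfl

theorem nontrivial_dupIdeal [Module.Finite ℂ 𝔤] (hB : IsQuadratic B) (hs : IsSingular hB) :
    Nontrivial (dupIdeal hB) := by
  have h := hs.2
  rw [dup, Nat.one_le_iff_ne_zero, Ne, Submodule.finrank_eq_zero, Submodule.eq_bot_iff] at h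
  push Not at h
  obtain ⟨α, hα, hα0⟩ := h
  obtain ⟨X, rfl⟩ := (B.toDual hB.nondegenerate).surjective α
  refine nontrivial_of_ne ⟨X, fun x y z w => ?_⟩ 0 fun h => hα0 ?_
  · have h1 := congrArg (fun f => f ![x, y, z, w]) (LinearMap.mem_ker.1 hα)
    rw [wedgeRight_threeForm_apply] at h1
    exact h1
  · have h1 : X = 0 := congrArg Subtype.val h
    rw [h1, map_zero]

/-- A solvable singular quadratic Lie algebra has a central isotropic vector `X` with
`B(X, ·) ∧ I = 0`. -/
theorem exists_central_mem_dupIdeal [Module.Finite ℂ 𝔤] [LieAlgebra.IsSolvable 𝔤]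
    (hB : IsQuadratic B) (hs : IsSingular hB) :
    ∃ X ∈ dupIdeal hB, X ≠ 0 ∧ (∀ z : 𝔤, ⁅z, X⁆ = 0) ∧ B X X = 0 := by
  have := nontrivial_dupIdeal hB hs
  -- Lie's theorem gives a common eigenvector `X`. By invariance the product of the linear forms `χ`
  -- and `B X` vanishes identically; as `B X ≠ 0`, this forces `χ = 0`.
  obtain ⟨χ, hχ⟩ := LieModule.exists_nontrivial_weightSpace_of_isSolvable ℂ 𝔤 (dupIdeal hB)
  obtain ⟨⟨X, hX⟩, hX0⟩ := exists_ne (0 : LieModule.weightSpace (dupIdeal hB) χ)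
  rw [LieModule.mem_weightSpace] at hX
  have hX0' : (X : 𝔤) ≠ 0 := fun h => hX0 (Subtype.ext (Subtype.ext h))
  have hXχ : ∀ z : 𝔤, ⁅z, (X : 𝔤)⁆ = χ z • (X : 𝔤) := fun z => congrArg Subtype.val (hX z)
  have hmul : ∀ z : 𝔤, χ z * B X z = 0 := by
    intro z
    have h1 : B ⁅z, (X : 𝔤)⁆ z = 0 := by
      rw [← lie_skew, map_neg, LinearMap.neg_apply, hB.invariant, lie_self, map_zero, neg_zero]
    rwa [hXχ, map_smul, LinearMap.smul_apply, smul_eq_mul] at h1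
  obtain ⟨e, he⟩ := exists_apply_eq_one hB.nondegenerate hX0'
  have hχe : χ e = 0 := by simpa [he] using hmul e
  have hχ0 : ∀ z, χ z = 0 := by
    intro z
    have h1 := hmul z
    have h2 := hmul (e + z)
    rw [map_add, map_add, hχe, he] at h2
    linear_combination h2 - h1
  have hcent : ∀ z : 𝔤, ⁅z, (X : 𝔤)⁆ = 0 := fun z => by rw [hXχ, hχ0, zero_smul]
  refine ⟨X, X.2, hX0', hcent, ?_⟩
  by_contra hXX
  refine hs.1 ⟨fun y z => ?_⟩
  refine hB.nondegenerate.1 _ fun w => ?_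
  -- With the central `X` as first argument only `B(X,X) I(y,z,w)` survives, so `B(X,X) ≠ 0` would
  -- make the algebra Abelian.
  have h1 := (mem_dupIdeal hB).1 X.2 X y z w
  have hcent' : ∀ z : 𝔤, ⁅(X : 𝔤), z⁆ = 0 := fun z => by rw [← lie_skew, hcent, neg_zero]
  simp only [hcent', map_zero, LinearMap.zero_apply, mul_zero, sub_zero, add_zero] at h1
  exact (mul_eq_zero.1 h1).resolve_left hXX

theorem nonempty_doubleExtension [Module.Finite ℂ 𝔤] [LieAlgebra.IsSolvable 𝔤]
    (hB : IsQuadratic B) (hs : IsSingular hB) : Nonempty (DoubleExtension B) := by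
  obtain ⟨X, hX, hX0, hcent, hXX⟩ := exists_central_mem_dupIdeal hB hs
  obtain ⟨e, he⟩ := exists_apply_eq_one hB.nondegenerate hX0
  obtain ⟨Y, hXY, hYY⟩ : ∃ Y, B X Y = 1 ∧ B Y Y = 0 := by
    -- Subtracting this multiple of the isotropic `X` makes `e` isotropic and keeps its pairing with
    -- `X`.
    refine ⟨e - (B e e / 2) • X, ?_, ?_⟩
    · simp [he, hXX]
    · have : B e X = 1 := by rw [hB.symm, he]
      simp only [map_sub, map_smul, LinearMap.sub_apply, LinearMap.smul_apply, smul_eq_mul, he, hXX,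
        this]
      ring
  have hYX : B Y X = 1 := by rw [hB.symm, hXY]
  have hcent' : ∀ z : 𝔤, ⁅X, z⁆ = 0 := fun z => by rw [← lie_skew, hcent, neg_zero]
  have hlieXX : ∀ z, B X ⁅Y, z⁆ = 0 := fun z => by
    rw [← hB.invariant, hcent', map_zero, LinearMap.zero_apply]
  have hlieYY : ∀ z, B Y ⁅Y, z⁆ = 0 := fun z => by
    rw [← hB.invariant, lie_self, map_zero, LinearMap.zero_apply]
  let q : Submodule ℂ 𝔤 := LinearMap.ker (B X) ⊓ LinearMap.ker (B Y)
  have hq : ∀ z, z ∈ q ↔ B X z = 0 ∧ B Y z = 0 := fun z => Iff.rfl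
  let C : q →ₗ[ℂ] q := (LieAlgebra.ad ℂ 𝔤 Y).restrict fun z _ => ⟨hlieXX z, hlieYY z⟩
  have hC : ∀ z : q, (C z : 𝔤) = ⁅Y, (z : 𝔤)⁆ := fun z => rfl
  have hqq : ∀ x y : q, ⁅(x : 𝔤), (y : 𝔤)⁆ = B ⁅Y, (x : 𝔤)⁆ y • X := by
    intro x y
    rw [← sub_eq_zero]
    refine hB.nondegenerate.1 _ fun w => ?_
    -- Taking `Y` as first argument, with `B(X,Y) = 1` and `x`, `y` orthogonal to `X`, the vanishing
    -- of `α ∧ I` becomes the formula for the bracket on `𝔮`.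
    have h1 := (mem_dupIdeal hB).1 hX Y x y w
    rw [hXY, ((hq x).1 x.2).1, ((hq y).1 y.2).1] at h1
    simp only [map_sub, LinearMap.sub_apply, map_smul, LinearMap.smul_apply, smul_eq_mul]
    linear_combination h1
  refine ⟨{
    X₀ := X
    Y₀ := Y
    𝔮 := q
    C := C
    isCompl := ?_
    X₀_X₀ := hXX
    Y₀_Y₀ := hYY
    X₀_Y₀ := hXY
    X₀_ortho := fun x hx => hx.1
    Y₀_ortho := fun x hx => hx.2
    skew := ?_
    lie_eq := ?_ }⟩
  · constructor
    · rw [Submodule.disjoint_def]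
      intro z hz hzq
      obtain ⟨a, b, rfl⟩ := Submodule.mem_span_pair.1 hz
      rw [hq] at hzq
      simp only [map_add, map_smul, smul_eq_mul, hXX, hXY, hYX, hYY, mul_zero, mul_one, add_zero,
        zero_add] at hzq
      rw [hzq.1, hzq.2]
      simp
    · rw [codisjoint_iff, eq_top_iff]
      intro z _
      refine Submodule.mem_sup.2 ⟨B Y z • X + B X z • Y, Submodule.mem_span_pair.2 ⟨_, _, rfl⟩,
        z - (B Y z • X + B X z • Y), ?_, by abel⟩
      rw [hq]
      simp [hXX, hXY, hYX, hYY]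
  · intro x y
    rw [hC, hC, ← lie_skew, map_neg, LinearMap.neg_apply, hB.invariant]
  · intro x y a b a' b'
    simp only [add_lie, lie_add, smul_lie, lie_smul, hcent, hcent', lie_self, smul_zero, hqq, hC]
    rw [← lie_skew (x : 𝔤) Y]
    module

end Existence
end QuadLie

theorem proposition6p4 {𝔤 𝔤' : Type*}
    [LieRing 𝔤] [LieAlgebra ℂ 𝔤] [Module.Finite ℂ 𝔤] [LieAlgebra.IsSolvable 𝔤]
    [LieRing 𝔤'] [LieAlgebra ℂ 𝔤'] [Module.Finite ℂ 𝔤'] [LieAlgebra.IsSolvable 𝔤']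
    (B : LinearMap.BilinForm ℂ 𝔤) (B' : LinearMap.BilinForm ℂ 𝔤')
    (hB : QuadLie.IsQuadratic B) (hB' : QuadLie.IsQuadratic B')
    (hs : QuadLie.IsSingular hB) (hs' : QuadLie.IsSingular hB') :
    -- both algebras can be realized as double extensions, so they have Fitting components
    (Nonempty (QuadLie.DoubleExtension B) ∧ Nonempty (QuadLie.DoubleExtension B')) ∧
    -- whatever the chosen realizations, the Fitting components decide (i-)isomorphism
    (∀ (D : QuadLie.DoubleExtension B) (D' : QuadLie.DoubleExtension B'),
      (QuadLie.IIsomorphic B B' ↔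
        QuadLie.IIsomorphic D.formN D'.formN ∧ QuadLie.IIsomorphic D.formI D'.formI) ∧
      (QuadLie.Isomorphic 𝔤 𝔤' ↔
        QuadLie.Isomorphic D.gN D'.gN ∧ QuadLie.Isomorphic D.gI D'.gI)) ∧
    -- isomorphism and i-isomorphism coincide
    (QuadLie.Isomorphic 𝔤 𝔤' ↔ QuadLie.IIsomorphic B B') := by
  have hD := QuadLie.nonempty_doubleExtension hB hs
  have hD' := QuadLie.nonempty_doubleExtension hB' hs'
  refine ⟨⟨hD, hD'⟩, fun D D' => ?_, ?_⟩
  · have h := D.isExtension hB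
    have h' := D'.isExtension hB'
    obtain ⟨_, _, hN⟩ := D.exists_isExtension_gN hB
    obtain ⟨_, _, hN'⟩ := D'.exists_isExtension_gN hB'
    obtain ⟨_, _, hI⟩ := D.exists_isExtension_gI hB
    obtain ⟨_, _, hI'⟩ := D'.exists_isExtension_gI hB'
    exact ⟨by rw [h.iIsomorphic_iff h', hN.iIsomorphic_iff hN', hI.iIsomorphic_iff hI',
        D.scalarConj_iff D'],
      by rw [h.isomorphic_iff h', hN.isomorphic_iff hN', hI.isomorphic_iff hI',
        D.scalarConj_iff D']⟩
  · obtain ⟨D⟩ := hD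
    obtain ⟨D'⟩ := hD'
    have h := D.isExtension hB
    have h' := D'.isExtension hB'
    rw [h.isomorphic_iff h', h.iIsomorphic_iff h']

end
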